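/- Let $p$ be a prime, $K$ a field of characteristic $p$, $\delta:K\to K$ a derivation (an additive map with $\delta(ab)=a\delta(b)+\delta(a)b$) and $F=\{a\in K\mid\delta(a)=0\}$ its field of constants. Assume that $\delta$, as an $F$-linear endomorphism of $K$, has minimum polynomial $t^p-t\in F[t]$. Let $R=K[t;\delta]$ be the differential polynomial ring, whose elements are the polynomials $\sum a_it^i$ with $a_i\in K$, with term-wise addition and with the multiplication determined by $ta=at+\delta(a)$ for $a\in K$. Let $d\in K$ and $f=t^p-t-d\in R$, and let $(K,\delta,d)=S_f=R/Rf$ be the unital, not necessarily associative, $F$-algebra that consists of the $g\in R$ of degree less than $p$, with the multiplication $g\circ h=$ the remainder $r$ of $gh$ under right division by $f$ (that is, $gh=qf+r$ with $q,r\in R$, $\deg r<p$). For $z\in K$ let $V_p(z)\in K$ be the element with $(t-z)^p=t^p-V_p(z)$ in $R$; such an element exists. Then: (1) $(K,\delta,d)$ has dimension $p^2$ over $F$. (2) $(K,\delta,d)$ is a division algebra (it is nonzero, and all left and all right multiplications by nonzero elements are bijective) if and only if $V_p(z)-z\neq d$ for all $z\in K$, if and only if $z^p+\delta^{p-1}(z)-z\neq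 d$ for all $z\in K$. (3) The map $G=G_{\mathrm{id},-1}$, $\sum a_it^i\mapsto\sum a_i(t-1)^i$, is an $F$-algebra automorphism of $(K,\delta,d)$; it satisfies $G(t)=t-1$ and $G|_K=\mathrm{id}_K$, and it generates a cyclic subgroup of order $p$ of $\mathrm{Aut}_F((K,\delta,d))$. -/

import Mathlib

noncomputable section

open Polynomial

/-! ### Constants of a derivation -/

/-- The field of constants `Const(δ) = {a ∈ K | δ a = 0}` of a derivation of a field. -/
def constants {K : Type*} [Field K] (δ : Derivation ℤ K K) : Subfield K where
  carrier := {a | δ a = 0}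
  mul_mem' := by
    intro a b ha hb
    simp only [Set.mem_ofPred_eq] at ha hb ⊢
    simp [Derivation.leibniz, ha, hb]
  one_mem' := by simp
  add_mem' := by
    intro a b ha hb
    simp only [Set.mem_ofPred_eq] at ha hb ⊢
    simp [ha, hb]
  zero_mem' := by simp
  neg_mem' := by
    intro a ha
    simp only [Set.mem_ofPred_eq] at ha ⊢
    simp [ha]
  inv_mem' := by
    intro a ha
    simp only [Set.mem_ofPred_eq] at ha ⊢
    simp [Derivation.leibniz_inv, ha]

/-- A derivation of `K`, seen as an endomorphism of `K` as a vector space over its constants. -/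
def constLinear {K : Type*} [Field K] (δ : Derivation ℤ K K) :
    Module.End (constants δ) K where
  toFun := δ
  map_add' := δ.map_add
  map_smul' := by
    rintro ⟨c, hc⟩ x
    have hc' : δ c = 0 := hc
    change δ (c * x) = c * δ x
    simp [Derivation.leibniz, hc']

/-! ### The differential polynomial ring -/

/-- The differential polynomial ring `K[t;δ]`. Its elements are the polynomials
`a₀ + a₁ t + ⋯ + aₙ tⁿ` with coefficients written on the left; the addition is term-wise, and the
multiplication, defined below, is the one with `t a = a t + δ a`. -/
def DiffPoly {K : Type*} [Field K] (_δ : Derivation ℤ K K) : Type _ := K[X]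

namespace DiffPoly

variable {K : Type*} [Field K] {δ : Derivation ℤ K K}

instance : AddCommGroup (DiffPoly δ) := inferInstanceAs (AddCommGroup K[X])

instance : Module K (DiffPoly δ) := inferInstanceAs (Module K K[X])

/-- The ordinary polynomial with the same (left) coefficients. -/
def toPoly : DiffPoly δ ≃ₗ[K] K[X] := LinearEquiv.refl K K[X]

/-- The element `∑ aᵢ tⁱ` of `K[t;δ]`, for a polynomial `∑ aᵢ Xⁱ`. -/
def ofPoly : K[X] ≃ₗ[K] DiffPoly δ := LinearEquiv.refl K K[X]

@[simp] lemma toPoly_ofPoly (q : K[X]) : toPoly (ofPoly q : DiffPoly δ) = q := rfl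

@[simp] lemma ofPoly_toPoly (q : DiffPoly δ) : ofPoly (toPoly q) = q := rfl

/-- The application of `δ` to every coefficient. -/
def coeffDeriv (δ : Derivation ℤ K K) : K[X] →+ K[X] where
  toFun q := q.sum fun j b => monomial j (δ b)
  map_zero' := by simp
  map_add' x y := by
    rw [sum_add_index] <;> simp

@[simp] lemma coeffDeriv_monomial (j : ℕ) (b : K) :
    coeffDeriv δ (monomial j b) = monomial j (δ b) := by
  simp [coeffDeriv, sum_monomial_index]

/-- Left multiplication by `t`: `t (∑ bⱼ tʲ) = ∑ (bⱼ tʲ⁺¹ + δ(bⱼ) tʲ)`. -/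
def tMul (δ : Derivation ℤ K K) : K[X] →+ K[X] where
  toFun q := X * q + coeffDeriv δ q
  map_zero' := by simp
  map_add' x y := by
    rw [map_add]; ring

lemma tMul_apply (q : K[X]) : tMul δ q = X * q + coeffDeriv δ q := rfl

lemma tMul_monomial (j : ℕ) (b : K) :
    tMul δ (monomial j b) = monomial (j + 1) b + monomial j (δ b) := by
  rw [tMul_apply, X_mul_monomial, coeffDeriv_monomial]

lemma coeffDeriv_smul (a : K) (q : K[X]) :
    coeffDeriv δ (a • q) = a • coeffDeriv δ q + δ a • q := by
  induction q using Polynomial.induction_on' with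
  | add x y hx hy => simp only [smul_add, map_add, hx, hy]; abel
  | monomial n b =>
    simp only [smul_monomial, coeffDeriv_monomial, smul_eq_mul, Derivation.leibniz, map_add]
    rw [mul_comm b]

lemma tMul_smul (a : K) (q : K[X]) : tMul δ (a • q) = a • tMul δ q + δ a • q := by
  rw [tMul_apply, tMul_apply, coeffDeriv_smul, mul_smul_comm, smul_add]; abel

/-- The product of `∑ aᵢ tⁱ` and `q`, namely `∑ aᵢ (t (t (⋯ (t q))))` with `i` factors `t`. -/
def leftMul (δ : Derivation ℤ K K) (g q : K[X]) : K[X] :=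
  g.sum fun i a => a • (tMul δ)^[i] q

lemma leftMul_monomial (i : ℕ) (a : K) (q : K[X]) :
    leftMul δ (monomial i a) q = a • (tMul δ)^[i] q :=
  sum_monomial_index _ _ (zero_smul K _)

lemma add_leftMul (g h q : K[X]) : leftMul δ (g + h) q = leftMul δ g q + leftMul δ h q :=
  sum_add_index _ _ _ (fun _ => zero_smul K _) (fun _ _ _ => add_smul _ _ _)

lemma zero_leftMul (q : K[X]) : leftMul δ 0 q = 0 := sum_zero_index _

lemma leftMul_add (g x y : K[X]) : leftMul δ g (x + y) = leftMul δ g x + leftMul δ g y := by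
  simp only [leftMul, iterate_map_add, smul_add]
  exact sum_add g _ _

lemma leftMul_zero (g : K[X]) : leftMul δ g 0 = 0 := by
  simp [leftMul, Polynomial.sum]

lemma smul_leftMul (a : K) (g q : K[X]) : leftMul δ (a • g) q = a • leftMul δ g q := by
  induction g using Polynomial.induction_on' with
  | add x y hx hy => rw [smul_add, add_leftMul, add_leftMul, hx, hy, smul_add]
  | monomial n b => rw [smul_monomial, leftMul_monomial, leftMul_monomial, smul_assoc]

lemma tMul_leftMul (g q : K[X]) : leftMul δ (tMul δ g) q = tMul δ (leftMul δ g q) := by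
  induction g using Polynomial.induction_on' with
  | add x y hx hy => rw [map_add, add_leftMul, add_leftMul, hx, hy, map_add]
  | monomial n b =>
    rw [tMul_monomial, add_leftMul, leftMul_monomial, leftMul_monomial,
      leftMul_monomial, tMul_smul, Function.iterate_succ_apply']

lemma leftMul_assoc (g h q : K[X]) :
    leftMul δ (leftMul δ g h) q = leftMul δ g (leftMul δ h q) := by
  induction g using Polynomial.induction_on' with
  | add x y hx hy => rw [add_leftMul, add_leftMul, add_leftMul, hx, hy]
  | monomial n b =>
    rw [leftMul_monomial, leftMul_monomial, smul_leftMul]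
    congr 1
    induction n with
    | zero => rfl
    | succ n ih => rw [Function.iterate_succ_apply', Function.iterate_succ_apply', tMul_leftMul, ih]

lemma one_leftMul (q : K[X]) : leftMul δ 1 q = q := by
  rw [← monomial_zero_one, leftMul_monomial, Function.iterate_zero_apply, one_smul]

lemma tMul_iterate_one (n : ℕ) : (tMul δ)^[n] (1 : K[X]) = X ^ n := by
  induction n with
  | zero => rfl
  | succ n ih =>
    rw [Function.iterate_succ_apply', ih, X_pow_eq_monomial, tMul_monomial,
      Derivation.map_one_eq_zero, map_zero, add_zero, ← X_pow_eq_monomial]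

lemma leftMul_one (g : K[X]) : leftMul δ g 1 = g := by
  induction g using Polynomial.induction_on' with
  | add x y hx hy => rw [add_leftMul, hx, hy]
  | monomial n b => rw [leftMul_monomial, tMul_iterate_one, ← C_mul_X_pow_eq_monomial, smul_eq_C_mul]

instance : One (DiffPoly δ) := ⟨ofPoly 1⟩

instance : Mul (DiffPoly δ) := ⟨fun g h => ofPoly (leftMul δ (toPoly g) (toPoly h))⟩

lemma toPoly_one : toPoly (1 : DiffPoly δ) = 1 := rfl

lemma toPoly_mul (g h : DiffPoly δ) : toPoly (g * h) = leftMul δ (toPoly g) (toPoly h) := rfl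

instance : Ring (DiffPoly δ) where
  __ := (inferInstance : AddCommGroup (DiffPoly δ))
  mul_assoc a b c := toPoly.injective <| by simp only [toPoly_mul, leftMul_assoc]
  one_mul a := toPoly.injective <| by rw [toPoly_mul, toPoly_one, one_leftMul]
  mul_one a := toPoly.injective <| by rw [toPoly_mul, toPoly_one, leftMul_one]
  left_distrib a b c := toPoly.injective <| by simp only [toPoly_mul, map_add, leftMul_add]
  right_distrib a b c := toPoly.injective <| by simp only [toPoly_mul, map_add, add_leftMul]
  zero_mul a := toPoly.injective <| by rw [toPoly_mul, map_zero, zero_leftMul]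
  mul_zero a := toPoly.injective <| by rw [toPoly_mul, map_zero, leftMul_zero]

/-- The indeterminate `t`. -/
def t : DiffPoly δ := ofPoly X

/-- The constant polynomial `a`. -/
def const (a : K) : DiffPoly δ := ofPoly (C a)

lemma toPoly_t : toPoly (t : DiffPoly δ) = X := rfl

lemma toPoly_const (a : K) : toPoly (const a : DiffPoly δ) = C a := rfl

lemma const_mul (a : K) (g : DiffPoly δ) : const a * g = a • g := by
  apply toPoly.injective
  rw [toPoly_mul, toPoly_const, ← monomial_zero_left, leftMul_monomial,
    Function.iterate_zero_apply, map_smul]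

/-- The commutation rule of `K[t;δ]`. -/
lemma t_mul_const (a : K) : (t : DiffPoly δ) * const a = const a * t + const (δ a) := by
  apply toPoly.injective
  rw [const_mul, map_add, map_smul, toPoly_mul, toPoly_t, toPoly_const, toPoly_const,
    ← monomial_one_one_eq_X, leftMul_monomial, Function.iterate_one, one_smul,
    ← monomial_zero_left, tMul_monomial, smul_monomial, smul_eq_mul, mul_one, zero_add,
    monomial_zero_left]

lemma smul_mul (a : K) (g h : DiffPoly δ) : (a • g) * h = a • (g * h) := by
  rw [← const_mul, ← const_mul, mul_assoc]

lemma tMul_iterate_smul_of_mem {c : K} (hc : c ∈ constants δ) (n : ℕ) (q : K[X]) :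
    (tMul δ)^[n] (c • q) = c • (tMul δ)^[n] q := by
  have hc' : δ c = 0 := hc
  induction n with
  | zero => rfl
  | succ n ih =>
    rw [Function.iterate_succ_apply', ih, tMul_smul, hc', zero_smul, add_zero,
      Function.iterate_succ_apply']

lemma mul_smul_of_mem {c : K} (hc : c ∈ constants δ) (g h : DiffPoly δ) :
    g * (c • h) = c • (g * h) := by
  apply toPoly.injective
  rw [toPoly_mul, map_smul, map_smul, toPoly_mul]
  simp only [leftMul, Polynomial.sum, tMul_iterate_smul_of_mem hc, Finset.smul_sum]
  exact Finset.sum_congr rfl fun _ _ => smul_comm _ _ _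

lemma toPoly_t_pow (n : ℕ) : toPoly ((t : DiffPoly δ) ^ n) = X ^ n := by
  induction n with
  | zero => rw [pow_zero, pow_zero, toPoly_one]
  | succ n ih =>
    have h : leftMul δ X (toPoly (t ^ n : DiffPoly δ)) = tMul δ (toPoly (t ^ n : DiffPoly δ)) := by
      rw [← monomial_one_one_eq_X, leftMul_monomial, Function.iterate_one, one_smul]
    rw [pow_succ', toPoly_mul, toPoly_t, h, ih, ← tMul_iterate_one (δ := δ) n,
      ← Function.iterate_succ_apply' (tMul δ), tMul_iterate_one]

/-- The degree, with `deg 0 = ⊥`. -/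
def degree (g : DiffPoly δ) : WithBot ℕ := (toPoly g).degree

lemma degree_tMul (q : K[X]) : (tMul δ q).degree = q.degree + 1 := by
  rcases eq_or_ne q 0 with rfl | hq
  · simp
  have h1 : (coeffDeriv δ q).degree ≤ q.degree := by
    change (q.sum fun j b => monomial j (δ b)).degree ≤ _
    refine (degree_sum_le _ _).trans (Finset.sup_le fun j hj => ?_)
    exact (degree_monomial_le _ _).trans (le_degree_of_mem_supp j hj)
  have h2 : (X * q).degree = q.degree + 1 := by rw [Polynomial.degree_mul, degree_X, add_comm]
  rw [tMul_apply, degree_add_eq_left_of_degree_lt, h2]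
  rw [h2]
  refine h1.trans_lt ?_
  rw [degree_eq_natDegree hq]
  exact_mod_cast Nat.lt_succ_self _

lemma degree_tMul_iterate (n : ℕ) (q : K[X]) : ((tMul δ)^[n] q).degree = q.degree + n := by
  induction n with
  | zero => simp
  | succ n ih =>
    rw [Function.iterate_succ_apply', degree_tMul, ih]; push_cast; rw [add_assoc]

lemma degree_smul_ne {a : K} (ha : a ≠ 0) (q : K[X]) : (a • q).degree = q.degree := by
  rw [smul_eq_C_mul, degree_C_mul ha]

lemma degree_mul (g h : DiffPoly δ) : (g * h).degree = g.degree + h.degree := by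
  unfold degree
  rw [toPoly_mul]
  generalize toPoly g = g
  generalize toPoly h = h
  rcases eq_or_ne h 0 with rfl | hh
  · simp [leftMul_zero]
  induction hn : g.natDegree using Nat.strong_induction_on generalizing g with
  | _ n ih =>
    rcases eq_or_ne g 0 with rfl | hg
    · simp [zero_leftMul]
    have hlead : (leftMul δ (monomial n g.leadingCoeff) h).degree = g.degree + h.degree := by
      rw [leftMul_monomial, degree_smul_ne (leadingCoeff_ne_zero.mpr hg), degree_tMul_iterate,
        degree_eq_natDegree hg, hn, add_comm]
    have hsplit : g = monomial n g.leadingCoeff + g.eraseLead := by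
      rw [← hn, add_comm]; exact (eraseLead_add_monomial_natDegree_leadingCoeff g).symm
    have herase : (leftMul δ g.eraseLead h).degree < g.degree + h.degree := by
      rcases eq_or_ne g.eraseLead 0 with h0 | h0
      · rw [h0, zero_leftMul, degree_zero, degree_eq_natDegree hg, degree_eq_natDegree hh]
        exact_mod_cast WithBot.bot_lt_coe _
      · have hlt : g.eraseLead.natDegree < n := by
          rw [← hn]; exact natDegree_lt_natDegree h0 (degree_eraseLead_lt hg)
        rw [ih _ hlt _ rfl, degree_eq_natDegree h0, degree_eq_natDegree hg,
          degree_eq_natDegree hh, hn]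
        exact_mod_cast Nat.add_lt_add_right hlt _
    conv_lhs => rw [hsplit]
    rw [add_leftMul, degree_add_eq_left_of_degree_lt, hlead]
    rw [hlead]; exact herase

lemma degree_add_lt {x y : DiffPoly δ} {n : WithBot ℕ} (hx : x.degree < n) (hy : y.degree < n) :
    (x + y).degree < n := by
  unfold degree at *
  rw [map_add]
  exact (degree_add_le _ _).trans_lt (max_lt hx hy)

lemma degree_smul_lt (c : K) {x : DiffPoly δ} {n : WithBot ℕ} (hx : x.degree < n) :
    (c • x).degree < n := by
  unfold degree at *
  rw [map_smul]
  exact (degree_smul_le _ _).trans_lt hx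

/-! ### Right division with remainder -/

lemma exists_eq_mul_add (f : DiffPoly δ) (hf : 0 < f.degree) (g : DiffPoly δ) :
    ∃ q r : DiffPoly δ, r.degree < f.degree ∧ g = q * f + r := by
  have hf0 : toPoly f ≠ 0 := by
    rintro h
    rw [degree, h, degree_zero] at hf
    exact not_lt_bot hf
  have hfd : f.degree = ((toPoly f).natDegree : ℕ) := degree_eq_natDegree hf0
  induction hn : (toPoly g).natDegree using Nat.strong_induction_on generalizing g with
  | _ n ih =>
    rcases lt_or_ge g.degree f.degree with hlt | hge
    · exact ⟨0, g, hlt, by rw [zero_mul, zero_add]⟩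
    have hg0 : toPoly g ≠ 0 := by
      rintro h
      rw [degree, degree, h, degree_zero, le_bot_iff, degree_eq_bot] at hge
      exact hf0 hge
    have hgd : g.degree = (n : ℕ) := by rw [degree, degree_eq_natDegree hg0, hn]
    have hmn : (toPoly f).natDegree ≤ n := by
      rw [hfd, hgd] at hge; exact_mod_cast hge
    set k := n - (toPoly f).natDegree with hk
    set m₀ : DiffPoly δ := t ^ k * f with hm₀
    have hm₀d : m₀.degree = (n : ℕ) := by
      rw [hm₀, degree_mul, hfd, degree, toPoly_t_pow, degree_X_pow]
      exact_mod_cast Nat.sub_add_cancel hmn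
    have hm₀0 : toPoly m₀ ≠ 0 := by
      rintro h
      rw [degree, h, degree_zero] at hm₀d
      exact WithBot.bot_ne_coe hm₀d
    set c : K := (toPoly g).leadingCoeff / (toPoly m₀).leadingCoeff with hc
    have hc0 : c ≠ 0 :=
      div_ne_zero (leadingCoeff_ne_zero.mpr hg0) (leadingCoeff_ne_zero.mpr hm₀0)
    have hsub : (toPoly (g - c • m₀)).degree < (toPoly g).degree := by
      rw [map_sub, map_smul]
      refine degree_sub_lt_left ?_ hg0 ?_
      · rw [degree_smul_ne hc0]; exact hgd.trans hm₀d.symm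
      · rw [smul_eq_C_mul, leadingCoeff_mul, leadingCoeff_C, hc,
          div_mul_cancel₀ _ (leadingCoeff_ne_zero.mpr hm₀0)]
    have hstep : ∃ q r : DiffPoly δ, r.degree < f.degree ∧ g - c • m₀ = q * f + r := by
      rcases eq_or_ne (toPoly (g - c • m₀)) 0 with h0 | h0
      · refine ⟨0, 0, ?_, ?_⟩
        · rw [degree, map_zero, degree_zero, hfd]; exact WithBot.bot_lt_coe _
        · rw [zero_mul, zero_add]; exact toPoly.injective (h0.trans (map_zero _).symm)
      · exact ih _ (by rw [← hn]; exact natDegree_lt_natDegree h0 hsub) _ rfl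
    obtain ⟨q, r, hr, hqr⟩ := hstep
    refine ⟨c • t ^ k + q, r, hr, ?_⟩
    rw [add_mul, smul_mul, ← hm₀, add_assoc, ← hqr]
    abel

lemma remainder_unique {f : DiffPoly δ} {q q' r r' : DiffPoly δ}
    (hr : r.degree < f.degree) (hr' : r'.degree < f.degree)
    (h : q * f + r = q' * f + r') : r = r' := by
  have h1 : (q - q') * f = r' - r := by
    rw [sub_mul, sub_eq_sub_iff_add_eq_add, h, add_comm]
  have h2 : (r' - r).degree < f.degree := by
    rw [sub_eq_add_neg, ← neg_one_smul K r]
    exact degree_add_lt hr' (degree_smul_lt _ hr)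
  rw [← h1, degree_mul] at h2
  have h3 : q - q' = 0 := by
    by_contra hne
    have hne' : toPoly (q - q') ≠ 0 := fun h0 => hne (toPoly.injective (h0.trans (map_zero _).symm))
    have : f.degree ≤ (q - q').degree + f.degree := by
      conv_lhs => rw [← zero_add f.degree]
      gcongr
      rw [degree, degree_eq_natDegree hne']
      exact_mod_cast Nat.zero_le _
    exact absurd h2 (not_lt.mpr this)
  rw [h3, zero_mul] at h1
  exact (sub_eq_zero.mp h1.symm).symm

/-- The remainder `g mod_r f` of the right division of `g` by `f`, that is, the element `r` with
`deg r < deg f` and `g = q f + r` for some `q`. -/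
def modr (f : DiffPoly δ) (hf : 0 < f.degree) (g : DiffPoly δ) : DiffPoly δ :=
  (exists_eq_mul_add f hf g).choose_spec.choose

lemma degree_modr_lt (f : DiffPoly δ) (hf : 0 < f.degree) (g : DiffPoly δ) :
    (modr f hf g).degree < f.degree :=
  (exists_eq_mul_add f hf g).choose_spec.choose_spec.1

lemma exists_eq_mul_add_modr (f : DiffPoly δ) (hf : 0 < f.degree) (g : DiffPoly δ) :
    ∃ q, g = q * f + modr f hf g :=
  ⟨_, (exists_eq_mul_add f hf g).choose_spec.choose_spec.2⟩

lemma modr_eq {f : DiffPoly δ} (hf : 0 < f.degree) {g q r : DiffPoly δ}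
    (hr : r.degree < f.degree) (h : g = q * f + r) : modr f hf g = r := by
  obtain ⟨q', hq'⟩ := exists_eq_mul_add_modr f hf g
  exact remainder_unique (degree_modr_lt f hf g) hr (hq'.symm.trans h)

lemma modr_of_lt {f : DiffPoly δ} (hf : 0 < f.degree) {g : DiffPoly δ}
    (hg : g.degree < f.degree) : modr f hf g = g :=
  modr_eq hf hg (q := 0) (by rw [zero_mul, zero_add])

lemma modr_add (f : DiffPoly δ) (hf : 0 < f.degree) (g h : DiffPoly δ) :
    modr f hf (g + h) = modr f hf g + modr f hf h := by
  obtain ⟨q, hq⟩ := exists_eq_mul_add_modr f hf g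
  obtain ⟨q', hq'⟩ := exists_eq_mul_add_modr f hf h
  refine modr_eq hf (q := q + q') (degree_add_lt (degree_modr_lt f hf g) (degree_modr_lt f hf h)) ?_
  conv_lhs => rw [hq, hq']
  rw [add_mul]; abel

lemma modr_smul (f : DiffPoly δ) (hf : 0 < f.degree) (c : K) (g : DiffPoly δ) :
    modr f hf (c • g) = c • modr f hf g := by
  obtain ⟨q, hq⟩ := exists_eq_mul_add_modr f hf g
  refine modr_eq hf (q := c • q) (degree_smul_lt c (degree_modr_lt f hf g)) ?_
  conv_lhs => rw [hq]
  rw [smul_add, smul_mul]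

/-- The `K`-subspace `R_m` of the elements of degree less than `m = deg f`. -/
def lowDegree (f : DiffPoly δ) (hf : 0 < f.degree) : Submodule K (DiffPoly δ) where
  carrier := {g | g.degree < f.degree}
  zero_mem' := by
    change (toPoly (0 : DiffPoly δ)).degree < f.degree
    rw [map_zero, degree_zero]; exact bot_le.trans_lt hf
  add_mem' := degree_add_lt
  smul_mem' c _ := degree_smul_lt c

/-- The map `G_{τ,a}` of `K[t;δ]` to itself, `∑ aᵢ tⁱ ↦ ∑ τ(aᵢ) (t + a)ⁱ`. -/
def substMap (δ : Derivation ℤ K K) (τ : K ≃+* K) (a : K) (g : DiffPoly δ) : DiffPoly δ :=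
  (toPoly g).sum fun i c => const (τ c) * (t + const a) ^ i

/-- `V_p(b)`: the element of `K` with `(t - b)^p = t^p - V_p(b)` in `K[t;δ]` in characteristic `p`,
read off as the constant coefficient of `t^p - (t - b)^p`. -/
def vMap (δ : Derivation ℤ K K) (p : ℕ) (b : K) : K :=
  (toPoly ((t : DiffPoly δ) ^ p - (t - const b) ^ p)).coeff 0

end DiffPoly

/-! ### Petit algebras -/

/-- The Petit algebra `S_f = K[t;δ]/K[t;δ]f`: the elements of `K[t;δ]` of degree less than `deg f`,
with the multiplication `g ∘ h = g h mod_r f`. -/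
def PetitAlgebra {K : Type*} [Field K] {δ : Derivation ℤ K K} (f : DiffPoly δ)
    (hf : 0 < f.degree) : Type _ := DiffPoly.lowDegree f hf

namespace PetitAlgebra

open DiffPoly

variable {K : Type*} [Field K] {δ : Derivation ℤ K K} {f : DiffPoly δ} {hf : 0 < f.degree}

instance : AddCommGroup (PetitAlgebra f hf) := inferInstanceAs (AddCommGroup (lowDegree f hf))

instance : Module K (PetitAlgebra f hf) := inferInstanceAs (Module K (lowDegree f hf))

/-- The underlying differential polynomial. -/
def val : PetitAlgebra f hf →ₗ[K] DiffPoly δ := (lowDegree f hf).subtype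

/-- The element of `S_f` given by a differential polynomial of degree less than `deg f`. -/
def mk (g : DiffPoly δ) (hg : g.degree < f.degree) : PetitAlgebra f hf := ⟨g, hg⟩

lemma val_mk (g : DiffPoly δ) (hg : g.degree < f.degree) :
    val (mk g hg : PetitAlgebra f hf) = g := rfl

lemma val_injective : Function.Injective (val : PetitAlgebra f hf →ₗ[K] DiffPoly δ) :=
  Subtype.val_injective

lemma degree_val_lt (x : PetitAlgebra f hf) : (val x).degree < f.degree := x.2

lemma degree_const_lt (hf : 0 < f.degree) (a : K) : (const a : DiffPoly δ).degree < f.degree :=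
  degree_C_le.trans_lt hf

/-- The element `a` of `S_f`, for `a ∈ K`. -/
def ofField (a : K) : PetitAlgebra f hf := mk (const a) (degree_const_lt hf a)

instance : Mul (PetitAlgebra f hf) :=
  ⟨fun g h => mk (modr f hf (val g * val h)) (degree_modr_lt f hf _)⟩

instance : One (PetitAlgebra f hf) := ⟨ofField 1⟩

lemma val_mul (g h : PetitAlgebra f hf) : val (g * h) = modr f hf (val g * val h) := rfl

lemma val_one : val (1 : PetitAlgebra f hf) = 1 := toPoly.injective <| by
  change toPoly (const (1 : K)) = _
  rw [toPoly_const, toPoly_one, C_1]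

lemma modr_zero : modr f hf 0 = 0 := by
  rw [← zero_smul K (0 : DiffPoly δ), modr_smul, zero_smul, zero_smul]

instance : NonAssocRing (PetitAlgebra f hf) where
  __ := (inferInstance : AddCommGroup (PetitAlgebra f hf))
  left_distrib a b c := val_injective <| by
    simp only [val_mul, map_add, mul_add, modr_add]
  right_distrib a b c := val_injective <| by
    simp only [val_mul, map_add, add_mul, modr_add]
  zero_mul a := val_injective <| by rw [val_mul, map_zero, zero_mul, modr_zero]
  mul_zero a := val_injective <| by rw [val_mul, map_zero, mul_zero, modr_zero]
  one_mul a := val_injective <| by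
    rw [val_mul, val_one, one_mul, modr_of_lt hf (degree_val_lt a)]
  mul_one a := val_injective <| by
    rw [val_mul, val_one, mul_one, modr_of_lt hf (degree_val_lt a)]

/-- The multiplication of `S_f` is bilinear over the constants. -/
instance : IsScalarTower (constants δ) (PetitAlgebra f hf) (PetitAlgebra f hf) where
  smul_assoc c x y := val_injective <| by
    change val (((c : K) • x) * y) = val ((c : K) • (x * y))
    rw [val_mul, map_smul, map_smul, smul_mul, modr_smul, val_mul]

instance : SMulCommClass (constants δ) (PetitAlgebra f hf) (PetitAlgebra f hf) where
  smul_comm c x y := val_injective <| by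
    change val ((c : K) • (x * y)) = val (x * ((c : K) • y))
    rw [val_mul, map_smul, map_smul, mul_smul_of_mem c.2, modr_smul, val_mul]

end PetitAlgebra

/-! ### Nonassociative division algebras and automorphisms -/

/-- A nonzero, not necessarily associative algebra is a division algebra if all the left and all
the right multiplications by nonzero elements are bijective. -/
def IsDivisionAlgebra (A : Type*) [NonAssocRing A] : Prop :=
  Nontrivial A ∧ ∀ a : A, a ≠ 0 →
    Function.Bijective (fun x : A => a * x) ∧ Function.Bijective (fun x : A => x * a)

/-- The group `Aut_F(A)` of the `F`-algebra automorphisms of a not necessarily associative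
algebra `A`, as a subgroup of the group of `F`-linear bijections of `A`. -/
def algebraAut (F A : Type*) [Field F] [NonAssocRing A] [Module F A] :
    Subgroup (A ≃ₗ[F] A) where
  carrier := {φ | ∀ x y : A, φ (x * y) = φ x * φ y}
  one_mem' _ _ := rfl
  mul_mem' := by
    intro φ ψ hφ hψ x y
    change φ (ψ (x * y)) = φ (ψ x) * φ (ψ y)
    rw [hψ, hφ]
  inv_mem' := by
    intro φ hφ x y
    change φ.symm (x * y) = φ.symm x * φ.symm y
    apply φ.injective
    rw [hφ, φ.apply_symm_apply, φ.apply_symm_apply, φ.apply_symm_apply]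

/-! ### The algebra `(K, δ, d)` -/

section

open DiffPoly

variable {K : Type*} [Field K]

/-- The polynomial `t^p - t - d` in `K[t;δ]`. -/
def cyclicPoly (δ : Derivation ℤ K K) (p : ℕ) (d : K) : DiffPoly δ := t ^ p - t - const d

lemma degree_cyclicPoly (δ : Derivation ℤ K K) (p : ℕ) [hp : Fact p.Prime] (d : K) :
    (cyclicPoly δ p d).degree = p := by
  have h1 : toPoly (cyclicPoly δ p d) = X ^ p - (X + C d) := by
    rw [cyclicPoly, map_sub, map_sub, toPoly_t_pow, toPoly_t, toPoly_const, sub_sub]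
  rw [DiffPoly.degree, h1, degree_sub_eq_left_of_degree_lt, degree_X_pow]
  rw [degree_X_pow, degree_X_add_C]
  exact_mod_cast hp.out.one_lt

lemma degree_cyclicPoly_pos (δ : Derivation ℤ K K) (p : ℕ) [hp : Fact p.Prime] (d : K) :
    0 < (cyclicPoly δ p d).degree := by
  rw [degree_cyclicPoly]
  exact_mod_cast hp.out.pos

/-- The algebra `(K, δ, d) = S_f` with `f = t^p - t - d`, for `δ` of minimum polynomial
`t^p - t`. -/
abbrev CyclicExt (δ : Derivation ℤ K K) (p : ℕ) [Fact p.Prime] (d : K) : Type _ :=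
  PetitAlgebra (cyclicPoly δ p d) (degree_cyclicPoly_pos δ p d)

/-- The element `t` of `(K, δ, d)`. -/
def CyclicExt.gen (δ : Derivation ℤ K K) (p : ℕ) [hp : Fact p.Prime] (d : K) : CyclicExt δ p d :=
  PetitAlgebra.mk t (by
    rw [degree_cyclicPoly, DiffPoly.degree, toPoly_t, degree_X]
    exact_mod_cast hp.out.one_lt)

end

end

/-!
The algebra `S_f` is a division algebra if and only if `f` is irreducible: for irreducible `f` the
left module `K[t;δ]/K[t;δ]f` is simple, and counting dimensions over `K` excludes zero divisors.

Suppose `f = t ^ p - t - d = g h` with `0 < m = deg h < p`. Left multiplication by `t` on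
`K[t;δ]/K[t;δ]h` is a connection `D` over `(K, δ)`, and `D ^ p - D` is triangular in the basis of
the powers of `t` with all diagonal entries equal to `d`. On the determinant line, `D` becomes a
connection of rank one with some matrix `c`, and Jacobson's formula for `p`-th powers turns the
trace of `D ^ p - D` into `V_p(c) - c = m d`. Since `V_p` is additive and `m` is invertible modulo
`p`, a multiple `z` of `c` satisfies `V_p(z) - z = d`. Conversely, such a `z` gives the
factorization `f = ((t - z) ^ (p - 1) - 1) (t - z)`.
-/

noncomputable section

open Polynomial

section CharP

attribute [local instance] LieRing.ofAssociativeRing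

variable {A : Type*} [Ring A] (p : ℕ)

lemma charP_intEnd [CharP A p] : CharP (Module.End ℤ A) p :=
  charP_of_injective_ringHom (f := (Algebra.lmul ℤ A).toRingHom) Algebra.lmul_injective p

variable [hp : Fact p.Prime] [CharP A p]

lemma cast_choose_pred_char {k : ℕ} (hk : k < p) : ((p - 1).choose k : A) = (-1) ^ k := by
  induction k with
  | zero => simp
  | succ k ih =>
    have pascal : p.choose (k + 1) = (p - 1).choose k + (p - 1).choose (k + 1) := by
      conv_lhs => rw [← Nat.sub_add_cancel hp.out.one_le]
      exact Nat.choose_succ_succ _ _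
    have hzero : (p.choose (k + 1) : A) = 0 :=
      (CharP.cast_eq_zero_iff A p _).mpr (hp.out.dvd_choose_self k.succ_ne_zero hk)
    rw [pascal, Nat.cast_add, ih (by omega)] at hzero
    rw [pow_succ, mul_neg_one]
    exact (neg_eq_of_add_eq_zero_right hzero).symm

lemma sub_pow_pred_char_of_commute {x y : A} (h : Commute x y) :
    (x - y) ^ (p - 1) = ∑ i ∈ Finset.range p, x ^ i * y ^ (p - 1 - i) := by
  rw [sub_eq_add_neg, h.neg_right.add_pow, Nat.sub_add_cancel hp.out.one_le]
  refine Finset.sum_congr rfl fun i hi => ?_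
  have hi : i < p := Finset.mem_range.mp hi
  rw [← Nat.choose_symm (by omega), cast_choose_pred_char p (by omega), mul_assoc,
    ← (Commute.neg_one_right (-y)).mul_pow, mul_neg_one, neg_neg]

lemma ad_pow_pred_char (u v : A) :
    (LieAlgebra.ad ℤ A u ^ (p - 1)) v = ∑ i ∈ Finset.range p, u ^ i * v * u ^ (p - 1 - i) := by
  have := charP_intEnd (A := A) p
  have h : (LieAlgebra.ad ℤ A u : Module.End ℤ A) =
      LinearMap.mulLeft ℤ u - LinearMap.mulRight ℤ u :=
    congrFun (LieAlgebra.ad_eq_lmul_left_sub_lmul_right A) u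
  rw [h, sub_pow_pred_char_of_commute p (LinearMap.commute_mulLeft_right u u),
    LinearMap.sum_apply]
  simp only [Module.End.mul_apply, LinearMap.pow_mulLeft, LinearMap.pow_mulRight,
    LinearMap.mulLeft_apply, LinearMap.mulRight_apply, mul_assoc]

end CharP

section Jacobson

attribute [local instance] LieRing.ofAssociativeRing

variable {A : Type*} [Ring A]

lemma derivative_pow_eq_sum (u : A[X]) (n : ℕ) :
    derivative (u ^ n) = ∑ i ∈ Finset.range n, u ^ i * derivative u * u ^ (n - 1 - i) := by
  induction n with
  | zero => simp
  | succ n ih =>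
    rw [pow_succ, derivative_mul, ih, Finset.sum_range_succ, Finset.sum_mul]
    simp only [Nat.add_sub_cancel, Nat.sub_self, pow_zero, mul_one]
    congr 1
    refine Finset.sum_congr rfl fun i hi => ?_
    have : n - i = n - 1 - i + 1 := by have := Finset.mem_range.mp hi; omega
    rw [this, pow_succ, mul_assoc _ (u ^ _) u]

lemma ad_pow_C_add_C_mul_X {a b : A} (hc : ∀ k, Commute b ((LieAlgebra.ad ℤ A a ^ k) b)) (k : ℕ) :
    (LieAlgebra.ad ℤ A[X] (C a + C b * X) ^ k) (C b) = C ((LieAlgebra.ad ℤ A a ^ k) b) := by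
  induction k with
  | zero => rfl
  | succ k ih =>
    rw [pow_succ', pow_succ', Module.End.mul_apply, Module.End.mul_apply, ih, LieAlgebra.ad_apply,
      LieAlgebra.ad_apply, Ring.lie_def, Ring.lie_def, add_mul, mul_add, mul_assoc _ X, X_mul_C,
      ← mul_assoc, ← mul_assoc, ← C_mul, ← C_mul, (hc k).eq, ← C_mul, ← C_mul, C_sub]
    abel

variable (p : ℕ) [hp : Fact p.Prime] [CharP A p]

lemma coeff_eq_zero_of_derivative_eq_C {q : A[X]} {c : A} (hq : derivative q = C c) {n : ℕ}
    (hn : 1 < n) (hnp : n < p) : q.coeff n = 0 := by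
  have h : q.coeff n * (n : A) = 0 := by
    obtain ⟨k, rfl⟩ : ∃ k, n = k + 2 := ⟨n - 2, by omega⟩
    have := congrArg (coeff · (k + 1)) hq
    simpa [coeff_derivative, coeff_C, add_assoc, one_add_one_eq_two] using this
  have hunit : IsUnit (n : A) := (CharP.isUnit_natCast_iff hp.out).mpr
    fun hdvd => absurd (Nat.le_of_dvd (by omega) hdvd) (by omega)
  exact hunit.mul_left_eq_zero.mp h

lemma eval_one_eq_of_derivative_eq_C {q : A[X]} {c : A} (hq : derivative q = C c)
    (hdeg : q.natDegree ≤ p) : q.eval 1 = q.coeff 0 + c + q.coeff p := by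
  have hcoeff_one : q.coeff 1 = c := by
    simpa [coeff_derivative] using congrArg (coeff · 0) hq
  rw [eval_eq_sum_range' (Nat.lt_succ_of_le hdeg), Finset.sum_range_succ, ← hcoeff_one]
  simp only [one_pow, mul_one]
  rw [← Finset.sum_subset (Finset.range_subset_range.mpr hp.out.two_le) fun n hn hn2 =>
      coeff_eq_zero_of_derivative_eq_C p hq (not_lt.mp (mt Finset.mem_range.mpr hn2))
        (Finset.mem_range.mp hn),
    Finset.sum_range_succ, Finset.sum_range_one]

/-- **Jacobson's formula**: the derivative of `(a + b X) ^ p` is constant, so that only the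
coefficients of `1`, `X` and `X ^ p` of this polynomial survive. -/
lemma add_pow_char_of_commute_ad {a b : A} (hc : ∀ k, Commute b ((LieAlgebra.ad ℤ A a ^ k) b)) :
    (a + b) ^ p = a ^ p + (LieAlgebra.ad ℤ A a ^ (p - 1)) b + b ^ p := by
  set u : A[X] := C a + C b * X with hu
  have hderiv : derivative (u ^ p) = C ((LieAlgebra.ad ℤ A a ^ (p - 1)) b) := by
    have hdu : derivative u = C b := by simp [hu]
    rw [derivative_pow_eq_sum, hdu, ← ad_pow_pred_char, ad_pow_C_add_C_mul_X hc]
  have hdeg : u.natDegree ≤ 1 := by rw [hu, add_comm]; exact natDegree_linear_le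
  have hdeg_pow : (u ^ p).natDegree ≤ p := by simpa using natDegree_pow_le_of_le p hdeg
  have heval (q : A[X]) : q.eval 1 = eval₂RingHom' (RingHom.id A) 1 Commute.one_right q := rfl
  have h := eval_one_eq_of_derivative_eq_C p hderiv hdeg_pow
  rw [heval, map_pow, ← heval] at h
  have h0 : (u ^ p).coeff 0 = a ^ p := by simpa [hu] using map_pow (constantCoeff (R := A)) u p
  have hp' : (u ^ p).coeff p = b ^ p := by
    simpa [hu] using coeff_pow_of_natDegree_le (m := p) hdeg
  rw [h0, hp'] at h
  simpa [hu] using h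

end Jacobson

section Derivation

attribute [local instance] LieRing.ofAssociativeRing

variable {R : Type*} [CommRing R] (δ : Derivation ℤ R R)

lemma iterate_derivation_one {n : ℕ} (hn : n ≠ 0) : δ^[n] 1 = 0 := by
  obtain ⟨n, rfl⟩ := Nat.exists_eq_succ_of_ne_zero hn
  rw [Function.iterate_succ_apply, Derivation.map_one_eq_zero, iterate_map_zero]

variable (p : ℕ) [hp : Fact p.Prime] [CharP R p]

/-- The additive map `V_p : a ↦ a ^ p + δ ^ (p - 1) a`, the closed form of `DiffPoly.vMap`. -/
def vHom : R →+ R :=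
  (frobenius R p : R →+ R) + ((δ : R →ₗ[ℤ] R) ^ (p - 1)).toAddMonoidHom

lemma vHom_apply (a : R) : vHom δ p a = a ^ p + δ^[p - 1] a := by
  simp [vHom, frobenius_def, Module.End.pow_apply]

variable {δ} {A : Type*} [Ring A] [CharP A p] {μ : R →+* A} {u : A}

lemma ad_pow_derivation (hu : ∀ a, u * μ a = μ a * u + μ (δ a)) (a : R) (k : ℕ) :
    (LieAlgebra.ad ℤ A u ^ k) (μ a) = μ (δ^[k] a) := by
  induction k with
  | zero => rfl
  | succ k ih =>
    rw [pow_succ', Module.End.mul_apply, ih, LieAlgebra.ad_apply, Ring.lie_def, hu,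
      add_sub_cancel_left, Function.iterate_succ_apply']

lemma add_pow_char_of_derivation (hu : ∀ a, u * μ a = μ a * u + μ (δ a)) (a : R) :
    (u + μ a) ^ p = u ^ p + μ (vHom δ p a) := by
  rw [add_pow_char_of_commute_ad p fun k => ?_, ad_pow_derivation hu, vHom_apply, map_add, map_pow,
    add_assoc, add_comm (μ _)]
  rw [ad_pow_derivation hu]
  exact (Commute.all a _).map μ

end Derivation

lemma sum_pow_char_of_commute {A κ : Type*} [Ring A] (p : ℕ) [hp : Fact p.Prime] [CharP A p]
    (s : Finset κ) (T : κ → A) (hT : ∀ i j, Commute (T i) (T j)) :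
    (∑ i ∈ s, T i) ^ p = ∑ i ∈ s, T i ^ p := by
  classical
  induction s using Finset.induction_on with
  | empty => simp [hp.out.ne_zero]
  | insert i s hi ih =>
    rw [Finset.sum_insert hi, Finset.sum_insert hi, ← ih]
    exact add_pow_char_of_commute p (Commute.sum_right _ _ _ fun j _ => hT i j)

section Connection

variable {R M ι : Type*} [CommRing R] [AddCommGroup M] [Module R M]

/-- A connection `D` on the module `M` over the differential ring `(R, δ)`: an additive map with
the Leibniz rule `D (a x) = a (D x) + δ(a) x`. -/
def IsConnection (δ : Derivation ℤ R R) (D : Module.End ℤ M) : Prop :=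
  ∀ (a : R) (x : M), D (a • x) = a • D x + δ a • x

variable [Fintype ι]

/-- The trace of the matrix of an additive map in a basis. For a connection, it is the matrix of the
connection induced on the determinant line. -/
def coordTrace (b : Module.Basis ι R M) : Module.End ℤ M →+ R where
  toFun D := ∑ i, b.repr (D (b i)) i
  map_zero' := by simp
  map_add' D E := by simp [Finset.sum_add_distrib]

lemma coordTrace_apply (b : Module.Basis ι R M) (D : Module.End ℤ M) :
    coordTrace b D = ∑ i, b.repr (D (b i)) i := rfl

variable [DecidableEq ι]

lemma det_update_basis (b : Module.Basis ι R M) (i : ι) (x : M) :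
    b.det (Function.update b i x) = b.repr x i := by
  rw [b.det_apply, b.toMatrix_update, b.toMatrix_self, ← Matrix.cramer_apply, Matrix.cramer_one,
    Module.End.one_apply]

variable {δ : Derivation ℤ R R} {D : Module.End ℤ M}

lemma sum_map_update_update {N : Type*} [AddCommMonoid N] (φ : (ι → M) → N) (v : ι → M) (i : ι)
    (x : M) :
    ∑ j, φ (Function.update (Function.update v i x) j (D (Function.update v i x j))) =
      φ (Function.update v i (D x)) +
        ∑ j ∈ Finset.univ.erase i, φ (Function.update (Function.update v j (D (v j))) i x) := by
  rw [← Finset.add_sum_erase _ _ (Finset.mem_univ i), Function.update_self, Function.update_idem]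
  refine congrArg _ (Finset.sum_congr rfl fun j hj => ?_)
  have hji : j ≠ i := Finset.ne_of_mem_erase hj
  rw [Function.update_of_ne hji, Function.update_comm hji]

lemma sum_map_update_eq_zero (φ : M [⋀^ι]→ₗ[R] R) {v : ι → M} {i j : ι} (hv : v i = v j)
    (hij : i ≠ j) : ∑ k, φ (Function.update v k (D (v k))) = 0 := by
  have hzero (k : ι) (hk : k ∉ ({i, j} : Finset ι)) : φ (Function.update v k (D (v k))) = 0 := by
    simp only [Finset.mem_insert, Finset.mem_singleton, not_or] at hk
    refine φ.map_eq_zero_of_eq _ ?_ hij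
    rw [Function.update_of_ne (Ne.symm hk.1), Function.update_of_ne (Ne.symm hk.2), hv]
  have hswap : Function.update v j (D (v j)) =
      Function.update v i (D (v i)) ∘ Equiv.swap i j := by
    ext k
    rcases eq_or_ne k i with rfl | hki
    · simp [Function.update_of_ne hij, Function.update_of_ne hij.symm, hv]
    rcases eq_or_ne k j with rfl | hkj
    · simp [hv]
    · simp [Equiv.swap_apply_of_ne_of_ne hki hkj, hki, hkj]
  rw [← Finset.sum_subset (Finset.subset_univ {i, j}) fun k _ hk => hzero k hk,
    Finset.sum_pair hij, hswap, φ.map_swap _ hij, add_neg_cancel]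

/-- The connection induced by `D` on the alternating forms. -/
def IsConnection.onForms (hD : IsConnection δ D) (φ : M [⋀^ι]→ₗ[R] R) : M [⋀^ι]→ₗ[R] R where
  __ := MultilinearMap.mk' (fun v => δ (φ v) - ∑ i, φ (Function.update v i (D (v i))))
    (fun v i x y => by
      simp only [sum_map_update_update (D := D) φ v i, map_add, φ.map_update_add,
        Finset.sum_add_distrib]
      abel)
    (fun v i a x => by
      simp only [sum_map_update_update (D := D) φ v i, hD a x, φ.map_update_add,
        φ.map_update_smul, Derivation.leibniz, smul_eq_mul, ← Finset.mul_sum]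
      ring)
  map_eq_zero_of_eq' v i j hv hij := by
    change δ (φ v) - ∑ k, φ (Function.update v k (D (v k))) = 0
    rw [φ.map_eq_zero_of_eq v hv hij, map_zero, sum_map_update_eq_zero φ hv hij, sub_zero]

lemma IsConnection.onForms_det (hD : IsConnection δ D) (b : Module.Basis ι R M) :
    hD.onForms b.det = -coordTrace b D • b.det := by
  rw [AlternatingMap.eq_smul_basis_det b (hD.onForms b.det)]
  congr 1
  change δ (b.det b) - ∑ i, b.det (Function.update b i (D (b i))) = _
  simp only [b.det_self, det_update_basis, Derivation.map_one_eq_zero, zero_sub, coordTrace_apply]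

end Connection

section FormOperators

variable {R M ι : Type*} [CommRing R] [AddCommGroup M] [DecidableEq ι]

/-- The operator `φ ↦ φ (…, D xᵢ, …)` on the functions of `x : ι → M`. -/
def slotOp (R : Type*) [CommRing R] (D : Module.End ℤ M) (i : ι) : Module.End ℤ ((ι → M) → R) :=
  LinearMap.funLeft ℤ R fun v => Function.update v i (D (v i))

lemma slotOp_apply (D : Module.End ℤ M) (i : ι) (φ : (ι → M) → R) (v : ι → M) :
    slotOp R D i φ v = φ (Function.update v i (D (v i))) := rfl

lemma slotOp_pow (D : Module.End ℤ M) (i : ι) (n : ℕ) : slotOp R D i ^ n = slotOp R (D ^ n) i := by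
  induction n with
  | zero => ext φ v; simp [slotOp_apply]
  | succ n ih =>
    ext φ v
    rw [pow_succ, Module.End.mul_apply, ih]
    simp only [slotOp_apply, Function.update_self, Function.update_idem, pow_succ',
      Module.End.mul_apply]

lemma commute_slotOp (D : Module.End ℤ M) (i j : ι) : Commute (slotOp R D i) (slotOp R D j) := by
  rcases eq_or_ne i j with rfl | hij
  · exact Commute.refl _
  refine LinearMap.ext fun φ => funext fun v => ?_
  simp only [Module.End.mul_apply, slotOp_apply, Function.update_of_ne hij,
    Function.update_of_ne hij.symm, Function.update_comm hij]

variable [Fintype ι]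

/-- The action of a connection `(δ, D)` on all the functions `(ι → M) → R`. -/
def formOp (ι : Type*) [Fintype ι] [DecidableEq ι] (δ : Derivation ℤ R R) (D : Module.End ℤ M) :
    Module.End ℤ ((ι → M) → R) :=
  (δ : R →ₗ[ℤ] R).compLeft (ι → M) - ∑ i, slotOp R D i

lemma formOp_apply (δ : Derivation ℤ R R) (D : Module.End ℤ M) (φ : (ι → M) → R) (v : ι → M) :
    formOp ι δ D φ v = δ (φ v) - ∑ i, φ (Function.update v i (D (v i))) := by
  simp [formOp, slotOp_apply]

lemma formOp_mul_toModuleEnd (δ : Derivation ℤ R R) (D : Module.End ℤ M) (a : R) :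
    formOp ι δ D * Module.toModuleEnd ℤ ((ι → M) → R) a =
      Module.toModuleEnd ℤ ((ι → M) → R) a * formOp ι δ D + Module.toModuleEnd ℤ _ (δ a) := by
  ext φ v
  simp only [Module.toModuleEnd_apply, Module.End.mul_apply, DistribSMul.toLinearMap_apply,
    formOp_apply, Pi.smul_apply, smul_eq_mul, Derivation.leibniz, LinearMap.add_apply, Pi.add_apply,
    mul_sub, Finset.mul_sum]
  ring

variable (p : ℕ)

lemma charP_end_fun (X : Type*) [Nonempty X] [CharP R p] : CharP (Module.End ℤ (X → R)) p :=
  charP_of_injective_ringHom (f := Module.toModuleEnd (S := R) ℤ (X → R)) (fun r s h => by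
    obtain ⟨x⟩ := ‹Nonempty X›
    simpa using congrFun (LinearMap.congr_fun h 1) x) p

variable [hp : Fact p.Prime] [CharP R p]

lemma formOp_pow_char_apply (δ : Derivation ℤ R R) (D : Module.End ℤ M) (φ : (ι → M) → R)
    (v : ι → M) :
    (formOp ι δ D ^ p) φ v = δ^[p] (φ v) - ∑ i, φ (Function.update v i ((D ^ p) (v i))) := by
  have := charP_end_fun (R := R) p (ι → M)
  have hcomm (i : ι) : Commute ((δ : R →ₗ[ℤ] R).compLeft (ι → M)) (slotOp R D i) := rfl
  have hiter (n : ℕ) : ((δ : R →ₗ[ℤ] R).compLeft (ι → M) ^ n) φ v = δ^[n] (φ v) := by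
    induction n with
    | zero => rfl
    | succ n ih =>
      rw [pow_succ', Module.End.mul_apply, Function.iterate_succ_apply', ← ih]; rfl
  rw [formOp, sub_pow_char_of_commute p (Commute.sum_right _ _ _ fun i _ => hcomm i),
    sum_pow_char_of_commute p _ _ (commute_slotOp D)]
  simp [slotOp_pow, slotOp_apply, hiter]

end FormOperators

/-- For modules of rank one this is `add_pow_char_of_derivation`. In general both sides describe the
action of `D` on the determinant form of `b`, and the operators in the slots commute. -/
theorem IsConnection.vHom_coordTrace {R M ι : Type*} [CommRing R] [AddCommGroup M] [Module R M]
    [Fintype ι] (p : ℕ) [hp : Fact p.Prime] [CharP R p] {δ : Derivation ℤ R R} {D : Module.End ℤ M}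
    (hD : IsConnection δ D) (b : Module.Basis ι R M) :
    vHom δ p (coordTrace b D) = coordTrace b (D ^ p) := by
  classical
  have := charP_end_fun (R := R) p (ι → M)
  set c := coordTrace b D with hc
  set μ := Module.toModuleEnd (S := R) ℤ ((ι → M) → R)
  have hdet : (formOp ι δ D + μ c) b.det = 0 := by
    ext v
    have h := DFunLike.congr_fun (hD.onForms_det b) v
    change δ (b.det v) - _ = _ at h
    simp [μ, formOp_apply, h, hc]
  have hpow : (formOp ι δ D ^ p + μ (vHom δ p c)) b.det b = 0 := by
    rw [← add_pow_char_of_derivation p (formOp_mul_toModuleEnd δ D) c,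
      ← Nat.sub_add_cancel hp.out.one_le, pow_succ, Module.End.mul_apply, hdet, map_zero,
      Pi.zero_apply]
  rw [LinearMap.add_apply, Pi.add_apply, formOp_pow_char_apply, b.det_self,
    iterate_derivation_one δ hp.out.ne_zero] at hpow
  simp only [det_update_basis, ← coordTrace_apply, zero_sub, Module.toModuleEnd_apply,
    DistribSMul.toLinearMap_apply, Pi.smul_apply, b.det_self, smul_eq_mul, mul_one, μ] at hpow
  linear_combination hpow

section RankKernel

variable {F V : Type*} [Field F] [AddCommGroup V] [Module F V] {φ : Module.End F V}

lemma rank_ker_aeval_prod_X_sub_C_le (hφ : ∀ c, Module.rank F (φ.eigenspace c) ≤ 1)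
    (s : Multiset F) :
    Module.rank F (LinearMap.ker (aeval φ (s.map (X - C ·)).prod)) ≤ s.card := by
  induction s using Multiset.induction_on with
  | empty =>
    rw [Multiset.map_zero, Multiset.prod_zero, map_one, Module.End.one_eq_id, LinearMap.ker_id,
      rank_bot]
    exact zero_le
  | cons c s ih =>
    have hker : LinearMap.ker (aeval φ (X - C c)) = φ.eigenspace c := by
      rw [Module.End.eigenspace_def, map_sub, aeval_X, aeval_C,
        Algebra.algebraMap_eq_smul_one]
    rw [Multiset.map_cons, Multiset.prod_cons, mul_comm, map_mul, Module.End.mul_eq_comp,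
      LinearMap.ker_comp, Multiset.card_cons, Nat.cast_succ]
    have h := LinearMap.lift_rank_comap_le (f := aeval φ (X - C c))
      (LinearMap.ker (aeval φ (s.map (X - C ·)).prod))
    rw [hker] at h
    simp only [Cardinal.lift_id] at h
    exact h.trans (add_le_add ih (hφ c))

lemma rank_le_natDegree_of_splits {q : F[X]} (hq : q.Splits) (hmonic : q.Monic)
    (hφ : ∀ c, Module.rank F (φ.eigenspace c) ≤ 1) (h : aeval φ q = 0) :
    Module.rank F V ≤ q.natDegree := by
  have hle := rank_ker_aeval_prod_X_sub_C_le hφ q.roots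
  rwa [← hq.eq_prod_roots_of_monic hmonic, h, LinearMap.ker_zero, rank_top,
    ← hq.natDegree_eq_card_roots] at hle

end RankKernel

section Constants

variable {K : Type*} [Field K] {δ : Derivation ℤ K K} {p : ℕ}

lemma rank_eigenspace_constLinear_le_one (c : constants δ) :
    Module.rank (constants δ) ((constLinear δ).eigenspace c) ≤ 1 := by
  rw [rank_submodule_le_one_iff]
  by_cases h : ∃ x ∈ (constLinear δ).eigenspace c, x ≠ 0
  · obtain ⟨x, hx, hx0⟩ := h
    refine ⟨x, hx, fun y hy => Submodule.mem_span_singleton.mpr ?_⟩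
    have hx' : δ x = c * x := Module.End.mem_eigenspace_iff.mp hx
    have hy' : δ y = c * y := Module.End.mem_eigenspace_iff.mp hy
    have hmem : δ (y / x) = 0 := by
      rw [Derivation.leibniz_div, hx', hy']
      simp only [smul_eq_mul]
      ring
    exact ⟨⟨y / x, hmem⟩, div_mul_cancel₀ y hx0⟩
  · push Not at h
    exact ⟨0, zero_mem _, fun y hy => by rw [h y hy]; exact zero_mem _⟩

lemma splits_X_pow_char_sub_X (F : Type*) [Field F] (p : ℕ) [hp : Fact p.Prime] [CharP F p] :
    (X ^ p - X : F[X]).Splits := by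
  have h := (FiniteField.splits_X_pow_card_sub_X p (K := ZMod p)).map (ZMod.castHom dvd_rfl F)
  simpa using h

lemma finrank_constants [hp : Fact p.Prime] [CharP K p]
    (hδ : minpoly (constants δ) (constLinear δ) = X ^ p - X) :
    Module.finrank (constants δ) K = p := by
  have hdeg : (X ^ p - X : (constants δ)[X]).natDegree = p :=
    FiniteField.X_pow_card_sub_X_natDegree_eq _ hp.out.one_lt
  have hmonic : (X ^ p - X : (constants δ)[X]).Monic :=
    monic_X_pow_sub (by rw [degree_X]; exact_mod_cast hp.out.one_lt)
  have hzero : aeval (constLinear δ) (X ^ p - X : (constants δ)[X]) = 0 := by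
    rw [← hδ, minpoly.aeval]
  have hle : Module.rank (constants δ) K ≤ p := by
    simpa only [hdeg] using rank_le_natDegree_of_splits (splits_X_pow_char_sub_X _ p) hmonic
      rank_eigenspace_constLinear_le_one hzero
  have : Module.Finite (constants δ) K :=
    Module.rank_lt_aleph0_iff.mp (hle.trans_lt Cardinal.natCast_lt_aleph0)
  refine le_antisymm (Module.finrank_le_of_rank_le hle) ?_
  rw [← LinearMap.charpoly_natDegree (constLinear δ), ← hdeg, ← hδ]
  exact natDegree_le_of_dvd (LinearMap.minpoly_dvd_charpoly _) (LinearMap.charpoly_monic _).ne_zero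

end Constants

namespace DiffPoly

variable {K : Type*} [Field K] {δ : Derivation ℤ K K}

instance : Nontrivial (DiffPoly δ) := inferInstanceAs (Nontrivial K[X])

/-- The inclusion of the constant polynomials, as a ring homomorphism. -/
def constHom (δ : Derivation ℤ K K) : K →+* DiffPoly δ where
  toFun := const
  map_one' := rfl
  map_mul' a b := toPoly.injective <| by
    rw [const_mul, map_smul, toPoly_const, toPoly_const, C_mul, smul_eq_C_mul]
  map_zero' := toPoly.injective <| by rw [toPoly_const, C_0, map_zero]
  map_add' a b := toPoly.injective <| by simp only [map_add, toPoly_const]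

lemma constHom_apply (a : K) : constHom δ a = const a := rfl

instance (p : ℕ) [CharP K p] : CharP (DiffPoly δ) p :=
  charP_of_injective_ringHom (f := constHom δ) (constHom δ).injective p

lemma t_mul (g : DiffPoly δ) : toPoly (t * g) = tMul δ (toPoly g) := by
  rw [toPoly_mul, toPoly_t, ← monomial_one_one_eq_X, leftMul_monomial, Function.iterate_one,
    one_smul]

lemma toPoly_t_pow_mul (n : ℕ) (g : DiffPoly δ) :
    toPoly (t ^ n * g) = (tMul δ)^[n] (toPoly g) := by
  rw [toPoly_mul, toPoly_t_pow, X_pow_eq_monomial, leftMul_monomial, one_smul]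

section Lift

variable {A : Type*} [Ring A] {μ : K →+* A} {u : A}

lemma eval₂_tMul (hu : ∀ a, u * μ a = μ a * u + μ (δ a)) (q : K[X]) :
    (tMul δ q).eval₂ μ u = u * q.eval₂ μ u := by
  induction q using Polynomial.induction_on' with
  | add x y hx hy => rw [map_add, eval₂_add, hx, hy, eval₂_add, mul_add]
  | monomial n b =>
    rw [tMul_monomial, eval₂_add, eval₂_monomial, eval₂_monomial, eval₂_monomial, pow_succ',
      ← mul_assoc, ← add_mul, ← hu, mul_assoc]

lemma eval₂_leftMul (hu : ∀ a, u * μ a = μ a * u + μ (δ a)) (g q : K[X]) :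
    (leftMul δ g q).eval₂ μ u = g.eval₂ μ u * q.eval₂ μ u := by
  have hiter (n : ℕ) : ((tMul δ)^[n] q).eval₂ μ u = u ^ n * q.eval₂ μ u := by
    induction n with
    | zero => rw [Function.iterate_zero_apply, pow_zero, one_mul]
    | succ n ih => rw [Function.iterate_succ_apply', eval₂_tMul hu, ih, pow_succ', mul_assoc]
  induction g using Polynomial.induction_on' with
  | add x y hx hy => rw [add_leftMul, eval₂_add, hx, hy, eval₂_add, add_mul]
  | monomial n b => rw [leftMul_monomial, eval₂_smul, hiter, eval₂_monomial, mul_assoc]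

/-- The universal property of `K[t;δ]`: the ring homomorphism that extends `μ` and sends `t` to
`u`. -/
def lift (μ : K →+* A) (u : A) (hu : ∀ a, u * μ a = μ a * u + μ (δ a)) : DiffPoly δ →+* A where
  toFun g := (toPoly g).eval₂ μ u
  map_one' := by rw [toPoly_one, eval₂_one]
  map_mul' g h := by rw [toPoly_mul, eval₂_leftMul hu]
  map_zero' := by rw [map_zero, eval₂_zero]
  map_add' g h := by rw [map_add, eval₂_add]

variable (hu : ∀ a, u * μ a = μ a * u + μ (δ a))

lemma lift_apply (g : DiffPoly δ) : lift μ u hu g = (toPoly g).eval₂ μ u := rfl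

lemma lift_const (a : K) : lift μ u hu (const a) = μ a := by
  rw [lift_apply, toPoly_const, eval₂_C]

lemma lift_t : lift μ u hu t = u := by rw [lift_apply, toPoly_t, eval₂_X]

lemma ringHom_ext {φ ψ : DiffPoly δ →+* A} (hconst : ∀ a, φ (const a) = ψ (const a))
    (ht : φ t = ψ t) : φ = ψ := by
  ext g
  suffices h : ∀ q : K[X], φ (ofPoly q) = ψ (ofPoly q) from h (toPoly g)
  intro q
  induction q using Polynomial.induction_on' with
  | add x y hx hy => simp only [map_add, hx, hy]
  | monomial n b =>
    have hmon : (ofPoly (monomial n b) : DiffPoly δ) = const b * t ^ n := toPoly.injective <| by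
      rw [const_mul, map_smul, toPoly_t_pow, toPoly_ofPoly, smul_X_eq_monomial]
    rw [hmon, map_mul, map_mul, map_pow, map_pow, hconst, ht]

end Lift

section Shift

lemma t_add_const_mul_const (a b : K) :
    (t + const a : DiffPoly δ) * constHom δ b =
      constHom δ b * (t + const a) + constHom δ (δ b) := by
  rw [constHom_apply, constHom_apply, add_mul, mul_add, t_mul_const, ← constHom_apply a,
    ← constHom_apply b, ← map_mul, ← map_mul, mul_comm a b]
  abel

/-- The automorphism `G_{id,a}` of `K[t;δ]`. -/
def shift (δ : Derivation ℤ K K) (a : K) : DiffPoly δ →+* DiffPoly δ :=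
  lift (constHom δ) (t + const a) (t_add_const_mul_const a)

lemma shift_const (a b : K) : shift δ a (const b) = const b := lift_const _ b

lemma shift_t (a : K) : shift δ a t = t + const a := lift_t _

lemma shift_smul (a b : K) (g : DiffPoly δ) : shift δ a (b • g) = b • shift δ a g := by
  rw [← const_mul, map_mul, shift_const, const_mul]

lemma substMap_refl_eq_shift (a : K) (g : DiffPoly δ) :
    substMap δ (RingEquiv.refl K) a g = shift δ a g := by
  rw [shift, lift_apply, eval₂_eq_sum]
  rfl

lemma shift_zero : shift δ 0 = RingHom.id (DiffPoly δ) :=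
  ringHom_ext (fun b => shift_const 0 b) <| by
    rw [shift_t, ← constHom_apply, map_zero, add_zero, RingHom.id_apply]

lemma shift_shift (a b : K) (g : DiffPoly δ) : shift δ a (shift δ b g) = shift δ (a + b) g := by
  suffices h : (shift δ a).comp (shift δ b) = shift δ (a + b) from DFunLike.congr_fun h g
  refine ringHom_ext (fun c => ?_) ?_
  · rw [RingHom.comp_apply, shift_const, shift_const, shift_const]
  · rw [RingHom.comp_apply, shift_t, map_add, shift_t, shift_const, shift_t, add_assoc,
      ← constHom_apply, ← constHom_apply, ← map_add, constHom_apply]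

lemma degree_t_add_const_pow (a : K) (n : ℕ) : ((t + const a : DiffPoly δ) ^ n).degree = n := by
  induction n with
  | zero => exact degree_one
  | succ n ih =>
    rw [pow_succ, degree_mul, ih, degree, map_add, toPoly_t, toPoly_const, degree_X_add_C,
      Nat.cast_succ]

lemma degree_shift_le (a : K) (g : DiffPoly δ) : (shift δ a g).degree ≤ g.degree := by
  rw [← substMap_refl_eq_shift, substMap, Polynomial.sum, degree, map_sum]
  refine (degree_sum_le _ _).trans (Finset.sup_le fun i hi => ?_)
  rw [const_mul, map_smul]
  exact (degree_smul_le _ _).trans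
    ((degree_t_add_const_pow a i).trans_le (le_degree_of_mem_supp i hi))

end Shift

section CharP

variable (p : ℕ) [hp : Fact p.Prime] [CharP K p]

lemma t_add_const_pow_char (a : K) :
    (t + const a : DiffPoly δ) ^ p = t ^ p + const (vHom δ p a) :=
  add_pow_char_of_derivation p (μ := constHom δ) t_mul_const a

lemma t_sub_const_pow_char (a : K) :
    (t - const a : DiffPoly δ) ^ p = t ^ p - const (vHom δ p a) := by
  have h := t_add_const_pow_char (δ := δ) p (-a)
  simpa only [← constHom_apply, map_neg, ← sub_eq_add_neg] using h

lemma vMap_eq_vHom (a : K) : vMap δ p a = vHom δ p a := by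
  rw [vMap, t_sub_const_pow_char, sub_sub_cancel, toPoly_const, coeff_C_zero]

lemma shift_cyclicPoly (a d : K) :
    shift δ a (cyclicPoly δ p d) = cyclicPoly δ p (d - (vHom δ p a - a)) := by
  rw [cyclicPoly, map_sub, map_sub, map_pow, shift_t, shift_const, t_add_const_pow_char, cyclicPoly]
  simp only [← constHom_apply, map_sub]
  abel

lemma shift_neg_one_cyclicPoly (d : K) : shift δ (-1) (cyclicPoly δ p d) = cyclicPoly δ p d := by
  have hone : vHom δ p (1 : K) = 1 := by
    rw [vHom_apply, iterate_derivation_one δ (Nat.sub_ne_zero_of_lt hp.out.one_lt), one_pow,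
      add_zero]
  rw [shift_cyclicPoly, map_neg, hone, sub_self, sub_zero]

lemma cyclicPoly_vHom_sub (z : K) :
    cyclicPoly δ p (vHom δ p z - z) = ((t - const z) ^ (p - 1) - 1) * (t - const z) := by
  rw [sub_mul, ← pow_succ, Nat.sub_add_cancel hp.out.one_le, t_sub_const_pow_char, one_mul,
    cyclicPoly, ← constHom_apply, map_sub]
  simp only [constHom_apply]
  abel

end CharP

section Euclidean

lemma degree_eq_bot_iff {g : DiffPoly δ} : g.degree = ⊥ ↔ g = 0 := by
  rw [degree, degree_eq_bot, LinearEquiv.map_eq_zero_iff]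

lemma degree_eq_toPoly_natDegree {g : DiffPoly δ} (hg : g ≠ 0) : g.degree = (toPoly g).natDegree :=
  Polynomial.degree_eq_natDegree fun h => hg (toPoly.injective h)

lemma ne_zero_of_degree_pos {g : DiffPoly δ} (hg : 0 < g.degree) : g ≠ 0 := by
  rintro rfl
  rw [degree_eq_bot_iff.mpr rfl] at hg
  exact not_lt_bot hg

lemma isUnit_iff {g : DiffPoly δ} : IsUnit g ↔ g.degree = 0 := by
  constructor
  · rintro ⟨g, rfl⟩
    have h : (g : DiffPoly δ).degree + (↑g⁻¹ : DiffPoly δ).degree = 0 := by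
      rw [← degree_mul, Units.mul_inv]
      exact degree_one
    exact (Nat.WithBot.add_eq_zero_iff.mp h).1
  · intro h
    have hC := eq_C_of_degree_eq_zero h
    have ha : (toPoly g).coeff 0 ≠ 0 := by
      intro h0
      rw [degree, hC, h0, C_0, degree_zero] at h
      exact absurd h (by decide)
    have hg : g = constHom δ ((toPoly g).coeff 0) := toPoly.injective hC
    rw [hg]
    exact (IsUnit.mk0 _ ha).map _

lemma degree_pos_of_not_isUnit {g : DiffPoly δ} (hg : g ≠ 0) (hunit : ¬IsUnit g) :
    0 < g.degree := by
  refine lt_of_le_of_ne ?_ fun h => hunit (isUnit_iff.mpr h.symm)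
  rw [degree_eq_toPoly_natDegree hg]
  exact_mod_cast Nat.zero_le _

lemma degree_lt_of_not_isUnit {g h : DiffPoly δ} (hgh : g * h ≠ 0) (hg : ¬IsUnit g)
    (hh : ¬IsUnit h) : g.degree < (g * h).degree ∧ h.degree < (g * h).degree := by
  have hg_pos := degree_pos_of_not_isUnit (left_ne_zero_of_mul hgh) hg
  have hh_pos := degree_pos_of_not_isUnit (right_ne_zero_of_mul hgh) hh
  rw [degree_mul]
  rw [degree_eq_toPoly_natDegree (left_ne_zero_of_mul hgh)] at hg_pos ⊢
  rw [degree_eq_toPoly_natDegree (right_ne_zero_of_mul hgh)] at hh_pos ⊢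
  norm_cast at hg_pos hh_pos ⊢
  omega

lemma exists_eq_mul_add_of_ne_zero {f : DiffPoly δ} (hf : f ≠ 0) (g : DiffPoly δ) :
    ∃ q r : DiffPoly δ, r.degree < f.degree ∧ g = q * f + r := by
  by_cases hunit : IsUnit f
  · have h : f.degree = 0 := isUnit_iff.mp hunit
    obtain ⟨u, rfl⟩ := hunit
    refine ⟨g * ↑u⁻¹, 0, ?_, by rw [Units.inv_mul_cancel_right, add_zero]⟩
    rw [h, degree_eq_bot_iff.mpr rfl]
    exact WithBot.bot_lt_coe 0
  · exact exists_eq_mul_add f (degree_pos_of_not_isUnit hf hunit) g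

instance : IsPrincipalIdealRing (DiffPoly δ) where
  principal I := by
    rcases eq_or_ne I ⊥ with rfl | hI
    · exact bot_isPrincipal
    obtain ⟨g, hgI, hg⟩ := Submodule.exists_mem_ne_zero_of_ne_bot hI
    obtain ⟨f, ⟨hfI, hf⟩, hmin⟩ := (InvImage.wf (degree (δ := δ)) wellFounded_lt).has_min
      {g | g ∈ I ∧ g ≠ 0} ⟨g, hgI, hg⟩
    refine ⟨f, le_antisymm (fun g hgI => ?_) ((Submodule.span_singleton_le_iff_mem f I).mpr hfI)⟩
    obtain ⟨q, r, hr, rfl⟩ := exists_eq_mul_add_of_ne_zero hf g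
    have hrI : r ∈ I := (I.add_mem_iff_right (I.mul_mem_left q hfI)).mp hgI
    have hr0 : r = 0 := by
      by_contra h
      exact hmin r ⟨hrI, h⟩ hr
    rw [hr0, add_zero]
    exact Submodule.mem_span_singleton.mpr ⟨q, rfl⟩

end Euclidean

lemma coeff_coeffDeriv (q : K[X]) (n : ℕ) : (coeffDeriv δ q).coeff n = δ (q.coeff n) := by
  induction q using Polynomial.induction_on' with
  | add x y hx hy => rw [map_add, coeff_add, hx, hy, coeff_add, map_add]
  | monomial m b => rw [coeffDeriv_monomial, coeff_monomial, coeff_monomial, apply_ite δ, map_zero]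

lemma degree_t_pow_mul_const_le (n : ℕ) (a : K) : (t ^ n * const a : DiffPoly δ).degree ≤ n := by
  rw [degree, toPoly_t_pow_mul, degree_tMul_iterate, toPoly_const]
  simpa using add_le_add_left (degree_C_le (a := a)) (n : WithBot ℕ)

lemma coeff_t_pow_mul_const (n : ℕ) (a : K) :
    (toPoly (t ^ n * const a : DiffPoly δ)).coeff n = a := by
  induction n with
  | zero => rw [pow_zero, one_mul, toPoly_const, coeff_C_zero]
  | succ n ih =>
    have hcoeff : (toPoly (t ^ n * const a : DiffPoly δ)).coeff (n + 1) = 0 :=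
      coeff_eq_zero_of_degree_lt <| (degree_t_pow_mul_const_le n a).trans_lt <| by
        exact_mod_cast n.lt_succ_self
    rw [pow_succ', mul_assoc, t_mul, tMul_apply, coeff_add, coeff_X_mul, ih, coeff_coeffDeriv,
      hcoeff, map_zero, add_zero]

end DiffPoly

section

variable {A : Type*} [NonAssocRing A]

lemma IsDivisionAlgebra.noZeroDivisors (h : IsDivisionAlgebra A) : NoZeroDivisors A where
  eq_zero_or_eq_zero_of_mul_eq_zero {x y} hxy := by
    by_contra! hne
    exact hne.2 ((h.2 x hne.1).1.injective (hxy.trans (mul_zero x).symm))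

lemma isDivisionAlgebra_of_noZeroDivisors (F : Type*) [Field F] [Module F A] [IsScalarTower F A A]
    [SMulCommClass F A A] [Module.Finite F A] [Nontrivial A] [NoZeroDivisors A] :
    IsDivisionAlgebra A := by
  refine ⟨inferInstance, fun a ha => ⟨?_, ?_⟩⟩
  · have hinj : Function.Injective (LinearMap.mulLeft F a) := mul_right_injective₀ ha
    exact ⟨hinj, LinearMap.surjective_of_injective hinj⟩
  · have hinj : Function.Injective (LinearMap.mulRight F a) := mul_left_injective₀ ha
    exact ⟨hinj, LinearMap.surjective_of_injective hinj⟩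

end

namespace PetitAlgebra

open DiffPoly

variable {K : Type*} [Field K] {δ : Derivation ℤ K K} {f : DiffPoly δ} {hf : 0 < f.degree}

/-- The class in `S_f`, that is, the remainder modulo `f`, of a differential polynomial. -/
def reduce (f : DiffPoly δ) (hf : 0 < f.degree) : DiffPoly δ →ₗ[K] PetitAlgebra f hf where
  toFun g := mk (modr f hf g) (degree_modr_lt f hf g)
  map_add' g h := val_injective (modr_add f hf g h)
  map_smul' a g := val_injective (modr_smul f hf a g)

lemma val_reduce_of_degree_lt {g : DiffPoly δ} (hg : g.degree < f.degree) :
    val (reduce f hf g) = g := modr_of_lt hf hg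

lemma reduce_val (x : PetitAlgebra f hf) : reduce f hf (val x) = x :=
  val_injective (val_reduce_of_degree_lt (degree_val_lt x))

lemma exists_eq_mul_add_val_reduce (f : DiffPoly δ) (hf : 0 < f.degree) (g : DiffPoly δ) :
    ∃ q, g = q * f + val (reduce f hf g) := exists_eq_mul_add_modr f hf g

lemma reduce_mul_self (q : DiffPoly δ) : reduce f hf (q * f) = 0 :=
  val_injective <| modr_eq hf (q := q) (by rw [map_zero]; exact degree_val_lt (hf := hf) 0)
    (by rw [map_zero, add_zero])

lemma reduce_self : reduce f hf f = 0 := by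
  simpa only [one_mul] using reduce_mul_self (hf := hf) 1

lemma reduce_mul_val_reduce (g h : DiffPoly δ) :
    reduce f hf (g * val (reduce f hf h)) = reduce f hf (g * h) := by
  obtain ⟨q, hq⟩ := exists_eq_mul_add_val_reduce f hf h
  conv_rhs => rw [hq, mul_add, ← mul_assoc, map_add, reduce_mul_self, zero_add]

/-- The structure of left `K[t;δ]`-module on `S_f = K[t;δ]/K[t;δ]f`. -/
instance : Module (DiffPoly δ) (PetitAlgebra f hf) where
  smul g x := reduce f hf (g * val x)
  one_smul x := (congrArg _ (one_mul _)).trans (reduce_val x)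
  mul_smul g h x := by
    change reduce f hf (g * h * val x) = reduce f hf (g * val (reduce f hf (h * val x)))
    rw [reduce_mul_val_reduce, mul_assoc]
  smul_zero g := by
    change reduce f hf (g * val 0) = 0
    rw [map_zero, mul_zero, map_zero]
  smul_add g x y := by
    change reduce f hf (g * val (x + y)) = reduce f hf (g * val x) + reduce f hf (g * val y)
    rw [map_add, mul_add, map_add]
  add_smul g h x := (congrArg _ (add_mul _ _ _)).trans (map_add _ _ _)
  zero_smul x := (congrArg _ (zero_mul _)).trans (map_zero _)

lemma smul_def (g : DiffPoly δ) (x : PetitAlgebra f hf) : g • x = reduce f hf (g * val x) := rfl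

lemma smul_reduce (g h : DiffPoly δ) : g • reduce f hf h = reduce f hf (g * h) :=
  reduce_mul_val_reduce g h

lemma const_smul (a : K) (x : PetitAlgebra f hf) : (const a : DiffPoly δ) • x = a • x := by
  rw [smul_def, const_mul, map_smul, reduce_val]

lemma val_smul_eq_mul (x y : PetitAlgebra f hf) : val x • y = x * y := rfl

lemma isConnection_t : IsConnection δ (Module.toModuleEnd ℤ (PetitAlgebra f hf) (t : DiffPoly δ)) :=
  fun a x => by
    change (t : DiffPoly δ) • a • x = a • (t : DiffPoly δ) • x + δ a • x
    rw [← const_smul, smul_smul, t_mul_const, add_smul, mul_smul, const_smul, const_smul]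

variable {n : ℕ}

/-- The `K`-basis `1, t, …, t ^ (n - 1)` of `S_f`, for `f` of degree `n`. -/
def powBasis (hf : 0 < f.degree) (hn : f.degree = n) :
    Module.Basis (Fin n) K (PetitAlgebra f hf) :=
  (degreeLT.basis K n).map (toPoly.ofSubmodules (lowDegree f hf) (degreeLT K n) (by
    ext q
    rw [Submodule.mem_map_equiv, mem_degreeLT, ← hn]
    rfl)).symm

lemma val_powBasis (hn : f.degree = n) (i : Fin n) : val (powBasis hf hn i) = t ^ (i : ℕ) := by
  apply toPoly.injective
  rw [toPoly_t_pow]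
  exact degreeLT.basis_val i

lemma powBasis_repr (hn : f.degree = n) (x : PetitAlgebra f hf) (i : Fin n) :
    (powBasis hf hn).repr x i = (toPoly (val x)).coeff i := rfl

lemma finrank_eq (hn : f.degree = n) : Module.finrank K (PetitAlgebra f hf) = n := by
  rw [Module.finrank_eq_card_basis (powBasis hf hn), Fintype.card_fin]

lemma finrank_constants_eq_mul (hn : f.degree = n) :
    Module.finrank (constants δ) (PetitAlgebra f hf) = Module.finrank (constants δ) K * n := by
  rw [← finrank_eq (hf := hf) hn, Module.finrank_mul_finrank]

instance : Module.Finite K (PetitAlgebra f hf) :=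
  .of_basis (powBasis hf (degree_eq_toPoly_natDegree (ne_zero_of_degree_pos hf)))

instance : Nontrivial (PetitAlgebra f hf) :=
  ⟨1, 0, fun h => one_ne_zero (by rw [← val_one (hf := hf), h, map_zero])⟩

lemma val_ne_zero {x : PetitAlgebra f hf} : val x ≠ 0 ↔ x ≠ 0 :=
  (map_ne_zero_iff val val_injective)

lemma exists_smul_eq (hirr : Irreducible f) {b : PetitAlgebra f hf} (hb : b ≠ 0)
    (y : PetitAlgebra f hf) : ∃ g : DiffPoly δ, g • b = y := by
  obtain ⟨h, hspan⟩ := IsPrincipalIdealRing.principal (Ideal.span {val b, f})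
  have hmem (g) (hg : g ∈ ({val b, f} : Set (DiffPoly δ))) : ∃ q, q * h = g :=
    Submodule.mem_span_singleton.mp (hspan ▸ Ideal.subset_span hg)
  obtain ⟨g, hgh⟩ := hmem f (by simp)
  rcases hirr.isUnit_or_isUnit hgh.symm with hg | hh
  · obtain ⟨e, he⟩ := hmem (val b) (by simp)
    obtain ⟨u, rfl⟩ := hg
    refine absurd ?_ hb
    rw [← reduce_val b, ← he, ← Units.inv_mul_cancel_left u h, hgh, ← mul_assoc, reduce_mul_self]
  · have hone : (1 : DiffPoly δ) ∈ Ideal.span {val b, f} := by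
      rw [hspan]
      obtain ⟨u, rfl⟩ := hh
      exact Submodule.mem_span_singleton.mpr ⟨_, u.inv_mul⟩
    obtain ⟨u, v, huv⟩ := Ideal.mem_span_pair.mp hone
    refine ⟨val y * u, ?_⟩
    rw [smul_def, mul_assoc, eq_sub_of_add_eq huv, mul_sub, mul_one, ← mul_assoc, map_sub,
      reduce_mul_self, sub_zero, reduce_val]

/-- If `x • b = 0`, then `g • b` depends only on `g` modulo `x`, so that `S_x` surjects onto the
simple module `S_f`. -/
lemma degree_le_of_smul_eq_zero (hirr : Irreducible f) {b : PetitAlgebra f hf} (hb : b ≠ 0)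
    {x : DiffPoly δ} (hx : x ≠ 0) (hxb : x • b = 0) : f.degree ≤ x.degree := by
  have hx_pos : 0 < x.degree := degree_pos_of_not_isUnit hx fun ⟨u, hu⟩ => hb <| by
    rw [← one_smul (DiffPoly δ) b, ← u.inv_mul, mul_smul, hu, hxb, smul_zero]
  let φ : PetitAlgebra x hx_pos →ₗ[K] PetitAlgebra f hf :=
    { toFun := fun r => val r • b
      map_add' := fun r s => by rw [map_add, add_smul]
      map_smul' := fun a r => by
        rw [map_smul, ← const_mul, mul_smul, const_smul, RingHom.id_apply] }
  have hφ : Function.Surjective φ := fun y => by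
    obtain ⟨g, hg⟩ := exists_smul_eq hirr hb y
    obtain ⟨q, hq⟩ := exists_eq_mul_add_val_reduce x hx_pos g
    refine ⟨reduce x hx_pos g, hg ▸ ?_⟩
    conv_rhs => rw [hq, add_smul, mul_smul, hxb, smul_zero, zero_add]
    rfl
  have hle := LinearMap.finrank_le_finrank_of_surjective hφ
  have hf0 : f ≠ 0 := hirr.ne_zero
  rw [finrank_eq (degree_eq_toPoly_natDegree hf0),
    finrank_eq (degree_eq_toPoly_natDegree hx)] at hle
  rw [degree_eq_toPoly_natDegree hf0, degree_eq_toPoly_natDegree hx]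
  exact_mod_cast hle

lemma noZeroDivisors_of_irreducible (hirr : Irreducible f) :
    NoZeroDivisors (PetitAlgebra f hf) where
  eq_zero_or_eq_zero_of_mul_eq_zero {x y} hxy := by
    by_contra! h
    exact (degree_val_lt x).not_ge
      (degree_le_of_smul_eq_zero hirr h.2 (val_ne_zero.mpr h.1) ((val_smul_eq_mul x y).trans hxy))

lemma irreducible_of_noZeroDivisors [NoZeroDivisors (PetitAlgebra f hf)] : Irreducible f where
  not_isUnit h := hf.ne' (isUnit_iff.mp h)
  isUnit_or_isUnit g h hgh := by
    by_contra! hunit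
    have hf0 : g * h ≠ 0 := hgh ▸ ne_zero_of_degree_pos hf
    obtain ⟨hg_lt, hh_lt⟩ := degree_lt_of_not_isUnit hf0 hunit.1 hunit.2
    rw [← hgh] at hg_lt hh_lt
    have hmul : reduce f hf g * reduce f hf h = 0 := by
      rw [← val_smul_eq_mul, val_reduce_of_degree_lt hg_lt, smul_reduce, ← hgh, reduce_self]
    rcases mul_eq_zero.mp hmul with h0 | h0
    · exact left_ne_zero_of_mul hf0 (by rw [← val_reduce_of_degree_lt hg_lt, h0, map_zero])
    · exact right_ne_zero_of_mul hf0 (by rw [← val_reduce_of_degree_lt hh_lt, h0, map_zero])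

theorem isDivisionAlgebra_iff_irreducible [Module.Finite (constants δ) K] :
    IsDivisionAlgebra (PetitAlgebra f hf) ↔ Irreducible f := by
  constructor
  · intro h
    have := h.noZeroDivisors
    exact irreducible_of_noZeroDivisors (hf := hf)
  · intro hirr
    have := noZeroDivisors_of_irreducible (hf := hf) hirr
    have : Module.Finite (constants δ) (PetitAlgebra f hf) := .trans K _
    exact isDivisionAlgebra_of_noZeroDivisors (constants δ)

end PetitAlgebra

section CyclicPoly

open DiffPoly PetitAlgebra

variable {K : Type*} [Field K] {δ : Derivation ℤ K K} (p : ℕ)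

/-- Modulo a right factor of `t ^ p - t - d`, the operator `t ^ p - t` maps
`t ^ i` to `t ^ i * d = d * t ^ i + ⋯`, so its matrix is triangular with diagonal entries `d`. -/
lemma coordTrace_powBasis_of_cyclicPoly_eq_mul {g h : DiffPoly δ} {d : K} {m : ℕ}
    (hgh : cyclicPoly δ p d = g * h) (hpos : 0 < h.degree) (hm : h.degree = m) :
    coordTrace (powBasis hpos hm) (Module.toModuleEnd ℤ _ (t ^ p - t : DiffPoly δ)) = m * d := by
  have hsplit : (t ^ p - t : DiffPoly δ) = g * h + const d := by
    rw [← hgh, cyclicPoly, sub_add_cancel]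
  have hcomm (i : ℕ) : Commute (t ^ p - t : DiffPoly δ) (t ^ i) :=
    ((Commute.refl t).pow_pow p i).sub_left ((Commute.refl t).pow_right i)
  have hcoeff (i : Fin m) :
      (powBasis hpos hm).repr ((t ^ p - t : DiffPoly δ) • powBasis hpos hm i) i = d := by
    have hsmul : (t ^ p - t : DiffPoly δ) • powBasis hpos hm i =
        reduce h hpos (t ^ (i : ℕ) * const d) := by
      rw [smul_def, val_powBasis, (hcomm i).eq, hsplit, mul_add, ← mul_assoc, map_add,
        reduce_mul_self, zero_add]
    have hdeg : (t ^ (i : ℕ) * const d : DiffPoly δ).degree < h.degree :=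
      (degree_t_pow_mul_const_le _ d).trans_lt (by rw [hm]; exact_mod_cast i.2)
    rw [hsmul, powBasis_repr, val_reduce_of_degree_lt hdeg, coeff_t_pow_mul_const]
  rw [coordTrace_apply]
  refine (Finset.sum_congr rfl fun i _ => hcoeff i).trans ?_
  rw [Finset.sum_const, Finset.card_univ, Fintype.card_fin, nsmul_eq_mul]

variable [hp : Fact p.Prime]

lemma exists_natCast_mul_eq_one (R : Type*) [NonAssocRing R] [CharP R p] {m : ℕ} (hm : 0 < m)
    (hmp : m < p) : ∃ n : ℕ, (n * m : R) = 1 := by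
  obtain ⟨n, -, hn⟩ := Nat.exists_mul_mod_eq_one_of_coprime
    (hp.out.coprime_iff_not_dvd.mpr (Nat.not_dvd_of_pos_of_lt hm hmp)).symm hp.out.one_lt
  refine ⟨n, ?_⟩
  rw [← Nat.cast_mul, ← Nat.cast_one, mul_comm, CharP.cast_eq_mod R p, hn]

variable [CharP K p]

lemma exists_vHom_sub_eq_of_cyclicPoly_eq_mul {g h : DiffPoly δ} {d : K}
    (hgh : cyclicPoly δ p d = g * h) (hg : ¬IsUnit g) (hh : ¬IsUnit h) :
    ∃ z, vHom δ p z - z = d := by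
  have hne : g * h ≠ 0 := hgh ▸ ne_zero_of_degree_pos (degree_cyclicPoly_pos δ p d)
  have hh0 : h ≠ 0 := right_ne_zero_of_mul hne
  have hpos := degree_pos_of_not_isUnit hh0 hh
  have hlt : h.degree < p := by
    rw [← degree_cyclicPoly δ p d, hgh]
    exact (degree_lt_of_not_isUnit hne hg hh).2
  have hm := degree_eq_toPoly_natDegree hh0
  set m := (toPoly h).natDegree
  set b := powBasis hpos hm
  set c := coordTrace b (Module.toModuleEnd ℤ _ (t : DiffPoly δ))
  have hc : vHom δ p c - c = m * d := by
    rw [isConnection_t.vHom_coordTrace p, ← map_pow, ← map_sub, ← map_sub,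
      coordTrace_powBasis_of_cyclicPoly_eq_mul p hgh]
  obtain ⟨n, hn⟩ := exists_natCast_mul_eq_one p K (m := m) (by rw [hm] at hpos; exact_mod_cast hpos)
    (by rw [hm] at hlt; exact_mod_cast hlt)
  refine ⟨n • c, ?_⟩
  rw [map_nsmul, ← smul_sub, hc, nsmul_eq_mul, ← mul_assoc, hn, one_mul]

theorem irreducible_cyclicPoly_iff {d : K} :
    Irreducible (cyclicPoly δ p d) ↔ ∀ z, vHom δ p z - z ≠ d := by
  constructor
  · rintro hirr z rfl
    have hlin : (t - const z : DiffPoly δ).degree = 1 := by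
      rw [DiffPoly.degree, map_sub, toPoly_t, toPoly_const, degree_X_sub_C]
    have hdeg := degree_cyclicPoly δ p (vHom δ p z - z)
    have hmul := cyclicPoly_vHom_sub (δ := δ) p z
    rcases hirr.isUnit_or_isUnit hmul with hunit | hunit
    · rw [hmul, DiffPoly.degree_mul, DiffPoly.isUnit_iff.mp hunit, hlin, zero_add] at hdeg
      exact hp.out.one_lt.ne (by exact_mod_cast hdeg)
    · rw [DiffPoly.isUnit_iff, hlin] at hunit
      exact one_ne_zero hunit
  · intro hd
    refine ⟨fun hunit => ?_, fun g h hgh => ?_⟩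
    · exact (degree_cyclicPoly_pos δ p d).ne' (DiffPoly.isUnit_iff.mp hunit)
    · by_contra! hunit
      obtain ⟨z, hz⟩ := exists_vHom_sub_eq_of_cyclicPoly_eq_mul p hgh hunit.1 hunit.2
      exact hd z hz

end CyclicPoly

namespace PetitAlgebra

open DiffPoly

variable {K : Type*} [Field K] {δ : Derivation ℤ K K} {f : DiffPoly δ}

/-- The endomorphism of `S_f` induced by `G_{id,a}`, for `f` fixed by `G_{id,a}`. -/
def shiftHom (hf : 0 < f.degree) (a : K) : PetitAlgebra f hf →ₗ[K] PetitAlgebra f hf where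
  toFun x := reduce f hf (shift δ a (val x))
  map_add' x y := by simp only [map_add]
  map_smul' b x := by rw [map_smul, shift_smul, map_smul, RingHom.id_apply]

variable {hf : 0 < f.degree}

lemma val_shiftHom (a : K) (x : PetitAlgebra f hf) :
    val (shiftHom hf a x) = shift δ a (val x) :=
  val_reduce_of_degree_lt ((degree_shift_le a _).trans_lt (degree_val_lt x))

lemma shiftHom_mul {a : K} (ha : shift δ a f = f) (x y : PetitAlgebra f hf) :
    shiftHom hf a (x * y) = shiftHom hf a x * shiftHom hf a y := by
  obtain ⟨q, hq⟩ := exists_eq_mul_add_val_reduce f hf (val x * val y)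
  rw [← val_smul_eq_mul (shiftHom hf a x), smul_def, val_shiftHom, val_shiftHom,
    ← map_mul (shift δ a), hq, map_add (shift δ a), map_mul (shift δ a), ha, map_add,
    reduce_mul_self, zero_add]
  rfl

lemma shiftHom_shiftHom (a b : K) (x : PetitAlgebra f hf) :
    shiftHom hf a (shiftHom hf b x) = shiftHom hf (a + b) x :=
  val_injective <| by rw [val_shiftHom, val_shiftHom, val_shiftHom, shift_shift]

lemma shiftHom_zero (x : PetitAlgebra f hf) : shiftHom hf 0 x = x :=
  val_injective <| by rw [val_shiftHom, shift_zero, RingHom.id_apply]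

/-- The automorphism of `S_f` induced by `G_{id,a}`, for `f` fixed by `G_{id,a}`. -/
def shiftAut (hf : 0 < f.degree) (a : K) (ha : shift δ a f = f) :
    algebraAut (constants δ) (PetitAlgebra f hf) where
  val := LinearEquiv.ofLinearMap ((shiftHom hf a).restrictScalars _)
    ((shiftHom hf (-a)).restrictScalars _)
    (LinearMap.ext fun x => by simp [shiftHom_shiftHom, shiftHom_zero])
    (LinearMap.ext fun x => by simp [shiftHom_shiftHom, shiftHom_zero])
  property := shiftHom_mul ha

variable {a : K} (ha : shift δ a f = f)

lemma val_shiftAut (x : PetitAlgebra f hf) :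
    val ((shiftAut hf a ha).1 x) = shift δ a (val x) := val_shiftHom a x

lemma val_shiftAut_pow (n : ℕ) (x : PetitAlgebra f hf) :
    val ((shiftAut hf a ha ^ n).1 x) = shift δ (n * a) (val x) := by
  induction n with
  | zero => rw [Nat.cast_zero, zero_mul, shift_zero]; rfl
  | succ n ih =>
    rw [pow_succ', Nat.cast_succ, add_one_mul, add_comm, ← shift_shift, ← ih]
    exact val_shiftAut ha _

lemma shiftAut_ofField (b : K) : (shiftAut hf a ha).1 (ofField b) = ofField b :=
  val_injective ((val_shiftAut ha _).trans (shift_const a b))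

lemma ofField_neg_one : (ofField (-1) : PetitAlgebra f hf) = -1 :=
  val_injective <| by rw [map_neg, val_one]; exact map_neg (constHom δ) 1

lemma shiftAut_mk_t (ht : (t : DiffPoly δ).degree < f.degree) :
    (shiftAut hf a ha).1 (mk t ht) = mk t ht + ofField a :=
  val_injective ((val_shiftAut ha _).trans (shift_t a))

lemma orderOf_shiftAut (p : ℕ) [Fact p.Prime] [CharP K p] (ha0 : a ≠ 0)
    (ht : (t : DiffPoly δ).degree < f.degree) : orderOf (shiftAut hf a ha) = p := by
  refine orderOf_eq_prime (Subtype.ext <| LinearEquiv.ext fun x => val_injective ?_) fun h => ha0 ?_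
  · rw [val_shiftAut_pow, CharP.cast_eq_zero, zero_mul, shift_zero]
    rfl
  · have hfix : mk t ht + ofField a = (mk t ht : PetitAlgebra f hf) := by
      rw [← shiftAut_mk_t ha ht, h]
      rfl
    have hconst : constHom δ a = 0 := congrArg val (add_eq_left.mp hfix)
    exact (map_eq_zero _).mp hconst

end PetitAlgebra

end

theorem mainTheorem2_general {K : Type*} [Field K] (p : ℕ) [Fact p.Prime] [CharP K p]
    (δ : Derivation ℤ K K) [Module.Finite (constants δ) K] (d : K) :
    Module.finrank (constants δ) (CyclicExt δ p d) = Module.finrank (constants δ) K * p ∧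
    (∀ z : K, ((DiffPoly.t : DiffPoly δ) - DiffPoly.const z) ^ p =
      DiffPoly.t ^ p - DiffPoly.const (DiffPoly.vMap δ p z)) ∧
    (IsDivisionAlgebra (CyclicExt δ p d) ↔ ∀ z : K, DiffPoly.vMap δ p z - z ≠ d) ∧
    (IsDivisionAlgebra (CyclicExt δ p d) ↔ ∀ z : K, z ^ p + δ^[p - 1] z - z ≠ d) ∧
    ∃ G : algebraAut (constants δ) (CyclicExt δ p d),
      (∀ x : CyclicExt δ p d,
        PetitAlgebra.val (G.1 x) =
          DiffPoly.substMap δ (RingEquiv.refl K) (-1) (PetitAlgebra.val x)) ∧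
      G.1 (CyclicExt.gen δ p d) = CyclicExt.gen δ p d - 1 ∧
      (∀ a : K, G.1 (PetitAlgebra.ofField a) = PetitAlgebra.ofField a) ∧
      IsCyclic (Subgroup.zpowers G) ∧
      Nat.card (Subgroup.zpowers G) = p := by
  have hdiv : IsDivisionAlgebra (CyclicExt δ p d) ↔ ∀ z : K, vHom δ p z - z ≠ d :=
    PetitAlgebra.isDivisionAlgebra_iff_irreducible.trans (irreducible_cyclicPoly_iff p)
  refine ⟨PetitAlgebra.finrank_constants_eq_mul (degree_cyclicPoly δ p d), fun z => ?_, ?_, ?_, ?_⟩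
  · rw [DiffPoly.vMap_eq_vHom, DiffPoly.t_sub_const_pow_char]
  · simpa only [DiffPoly.vMap_eq_vHom] using hdiv
  · simpa only [vHom_apply] using hdiv
  · have hG := DiffPoly.shift_neg_one_cyclicPoly (δ := δ) p d
    refine ⟨PetitAlgebra.shiftAut _ (-1) hG, fun x => ?_, ?_, PetitAlgebra.shiftAut_ofField hG,
      inferInstance, ?_⟩
    · rw [PetitAlgebra.val_shiftAut, DiffPoly.substMap_refl_eq_shift]
    · rw [CyclicExt.gen, PetitAlgebra.shiftAut_mk_t, PetitAlgebra.ofField_neg_one, ← sub_eq_add_neg]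
    · rw [Nat.card_zpowers, PetitAlgebra.orderOf_shiftAut hG p (neg_ne_zero.mpr one_ne_zero)
        (PetitAlgebra.degree_val_lt (CyclicExt.gen δ p d))]

theorem mainTheorem2 {K : Type*} [Field K] (p : ℕ) [Fact p.Prime] [CharP K p]
    (δ : Derivation ℤ K K)
    (hδ : minpoly (constants δ) (constLinear δ) = Polynomial.X ^ p - Polynomial.X)
    (d : K) :
    Module.finrank (constants δ) (CyclicExt δ p d) = p ^ 2 ∧
    (∀ z : K, ((DiffPoly.t : DiffPoly δ) - DiffPoly.const z) ^ p =
      DiffPoly.t ^ p - DiffPoly.const (DiffPoly.vMap δ p z)) ∧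
    (IsDivisionAlgebra (CyclicExt δ p d) ↔ ∀ z : K, DiffPoly.vMap δ p z - z ≠ d) ∧
    (IsDivisionAlgebra (CyclicExt δ p d) ↔ ∀ z : K, z ^ p + δ^[p - 1] z - z ≠ d) ∧
    ∃ G : algebraAut (constants δ) (CyclicExt δ p d),
      (∀ x : CyclicExt δ p d,
        PetitAlgebra.val (G.1 x) =
          DiffPoly.substMap δ (RingEquiv.refl K) (-1) (PetitAlgebra.val x)) ∧
      G.1 (CyclicExt.gen δ p d) = CyclicExt.gen δ p d - 1 ∧
      (∀ a : K, G.1 (PetitAlgebra.ofField a) = PetitAlgebra.ofField a) ∧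
      IsCyclic (Subgroup.zpowers G) ∧
      Nat.card (Subgroup.zpowers G) = p := by
  have hfin := finrank_constants hδ
  have : Module.Finite (constants δ) K :=
    Module.finite_of_finrank_pos (hfin ▸ (Fact.out : p.Prime).pos)
  simpa only [hfin, ← sq] using mainTheorem2_general p δ d
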